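/- Let $G$ be a plane triangulation with $n\ge 3$ vertices, i.e. a simple graph embedded in the plane such that every face, including the distinguished outer face, is bounded by a triangle. A \emph{3-orientation} of $G$ is an orientation of the inner edges (the edges not on the outer face) such that every inner vertex has out-degree $3$ and each of the three outer vertices has out-degree $0$. \emph{Flipping} a triangle ($3$-cycle) $t$ of $G$ that is a directed cycle in a 3-orientation means reversing its three edges; the flip is \emph{facial} if $t$ bounds a face. A triangle is \emph{separating} if deleting its three vertices disconnects $G$. For 3-orientations write $T\le T'$ if $T$ can be obtained from $T'$ by a (possibly empty) sequence of flips, each performed on a triangle that is counterclockwise at that moment. This order on the 3-orientations of $G$ has a unique minimum element $T_{\min}$, and for every 3-orientation $T$ and every triangle $t$ the number of times $t$ is flipped is the same in all sequences of flips of counterclockwise triangles that lead from $T$ to $T_{\min}$. This number is denoted by $\pi_T(t)$ and called the (flip) potential of $t$. Let $T_1$ and $T_2$ be two 3-orientations of $G$. Then $T_1$ can be obtained from $T_2$ by a sequence of facial flips (each of a clockwise or counterclockwise triangle) if and only if $\pi_{T_1}(t)-\pi_{T_2}(t)=0$ for all separating triangles $t$. Moreover, if $T_1$ can be obtained from $T_2$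 by a sequence of facial flips, then it can be obtained by $\mathcal O(n^2)$ facial flips, where the implied constant is absolute. -/

import Mathlib

universe u

/-- A rotation system of a graph: for every vertex, a cyclic order of the darts that leave it.
We read `rot d` as the next dart after `d` in counterclockwise order around the tail of `d`. -/
structure RotationSystem {V : Type u} (G : SimpleGraph V) where
  rot : Equiv.Perm G.Dart
  rot_fst : ∀ d, (rot d).fst = d.fst
  rot_cyclic : ∀ d d' : G.Dart, d.fst = d'.fst → rot.SameCycle d d'

namespace RotationSystem

variable {V : Type u} {G : SimpleGraph V} (R : RotationSystem G)

/-- The reversal of darts, as a permutation. -/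
def dartReversal (G : SimpleGraph V) : Equiv.Perm G.Dart where
  toFun := SimpleGraph.Dart.symm
  invFun := SimpleGraph.Dart.symm
  left_inv := SimpleGraph.Dart.symm_symm
  right_inv := SimpleGraph.Dart.symm_symm

/-- Walk along `d` with a face on the left-hand side; `facePerm d` is the next dart on the boundary
of that face: turn back at the head of `d`, then move on clockwise to the next dart. -/
def facePerm : Equiv.Perm G.Dart := R.rot⁻¹ * dartReversal G

/-- The faces: the orbits of the face permutation. -/
def Face : Type u := Quotient (Equiv.Perm.SameCycle.setoid R.facePerm)

/-- The face on the left-hand side of the dart `d`. -/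
def leftFace (d : G.Dart) : R.Face := Quotient.mk _ d

end RotationSystem

/-- A plane triangulation on the vertex set `V`: a connected simple graph with an embedding into
the oriented sphere (a rotation system satisfying Euler's formula `n - m + f = 2`) in which every
face is a triangle, together with the choice of one face as the outer face.
In a simple graph the orbits of the face permutation never have length one, so its third power is
the identity if and only if all of them have length three. -/
structure PlaneTriangulation (V : Type u) [Fintype V] where
  graph : SimpleGraph V
  connected : graph.Connected
  emb : RotationSystem graph
  euler : Nat.card V + Nat.card emb.Face = Nat.card graph.edgeSet + 2
  triangular : ∀ d, emb.facePerm (emb.facePerm (emb.facePerm d)) = d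
  outer : emb.Face

namespace PlaneTriangulation

variable {V : Type u} [Fintype V] [DecidableEq V] (G : PlaneTriangulation V)

/-- `v` lies on the boundary of the outer face. -/
def IsOuterVertex (v : V) : Prop := ∃ d : G.graph.Dart, G.emb.leftFace d = G.outer ∧ d.fst = v

/-- The edge underlying the dart `d` lies on the boundary of the outer face. -/
def IsOuterDart (d : G.graph.Dart) : Prop :=
  G.emb.leftFace d = G.outer ∨ G.emb.leftFace d.symm = G.outer

/-- `C` consists of the three darts of a closed directed walk of length three in the graph, with
vertex set `t`. Since the graph has no loops, this is a directed triangle. -/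
def IsDirectedTriangle (t : Finset V) (C : Set G.graph.Dart) : Prop :=
  ∃ d₁ d₂ d₃ : G.graph.Dart, d₁.snd = d₂.fst ∧ d₂.snd = d₃.fst ∧ d₃.snd = d₁.fst ∧
    C = {d₁, d₂, d₃} ∧ t = {d₁.fst, d₂.fst, d₃.fst}

/-- The directed cycle with dart set `C` is counterclockwise, that is, its interior is on the
left-hand side: for some set `S` of inner faces (the faces in the interior), the darts of `C` are
exactly the darts with a face of `S` on the left and a face outside `S` on the right. -/
def IsCounterclockwise (C : Set G.graph.Dart) : Prop :=
  ∃ S : Set G.emb.Face, G.outer ∉ S ∧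
    ∀ d : G.graph.Dart, d ∈ C ↔ G.emb.leftFace d ∈ S ∧ G.emb.leftFace d.symm ∉ S

/-- `t` is the vertex set of a facial triangle. -/
def IsFacial (t : Finset V) : Prop :=
  ∃ d : G.graph.Dart,
    t = {d.fst, (G.emb.facePerm d).fst, (G.emb.facePerm (G.emb.facePerm d)).fst}

/-- `t` is a separating triangle: three pairwise adjacent vertices whose removal disconnects the
graph. -/
def IsSeparatingTriangle (t : Finset V) : Prop :=
  G.graph.IsNClique 3 t ∧ ¬ (G.graph.induce {v | v ∉ t}).Preconnected

/-- A 3-orientation: every inner edge gets exactly one of its two directions, outer edges get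
none, every inner vertex has out-degree 3 and every outer vertex has out-degree 0. -/
structure ThreeOrientation where
  arcs : Set G.graph.Dart
  inner_edge : ∀ d, ¬ G.IsOuterDart d → (d ∈ arcs ↔ d.symm ∉ arcs)
  outer_edge : ∀ d, G.IsOuterDart d → d ∉ arcs
  inner_vertex : ∀ v, ¬ G.IsOuterVertex v → {d ∈ arcs | d.fst = v}.ncard = 3
  outer_vertex : ∀ v, G.IsOuterVertex v → {d ∈ arcs | d.fst = v}.ncard = 0

namespace ThreeOrientation

variable {G}

/-- `T'` arises from `T` by flipping (reversing) the triangle `t`, which is oriented in `T`. -/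
def IsFlip (T : G.ThreeOrientation) (t : Finset V) (T' : G.ThreeOrientation) : Prop :=
  ∃ C, G.IsDirectedTriangle t C ∧ C ⊆ T.arcs ∧ T'.arcs = (T.arcs \ C) ∪ {d | d.symm ∈ C}

/-- `T'` arises from `T` by flipping the triangle `t`, which is oriented counterclockwise
in `T`. -/
def IsCcwFlip (T : G.ThreeOrientation) (t : Finset V) (T' : G.ThreeOrientation) : Prop :=
  ∃ C, G.IsDirectedTriangle t C ∧ G.IsCounterclockwise C ∧ C ⊆ T.arcs ∧
    T'.arcs = (T.arcs \ C) ∪ {d | d.symm ∈ C}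

/-- `l` is a sequence of triangles whose flips, in this order, lead from `T` to `T'`. -/
inductive IsFlipSequence : G.ThreeOrientation → List (Finset V) → G.ThreeOrientation → Prop
  | nil (T : G.ThreeOrientation) : IsFlipSequence T [] T
  | cons {T S T' : G.ThreeOrientation} {t : Finset V} {l : List (Finset V)} :
      IsFlip T t S → IsFlipSequence S l T' → IsFlipSequence T (t :: l) T'

/-- `l` is a flip sequence from `T` to `T'` in which every triangle is counterclockwise at the
moment it is flipped. -/
inductive IsCcwFlipSequence : G.ThreeOrientation → List (Finset V) → G.ThreeOrientation → Prop
  | nil (T : G.ThreeOrientation) : IsCcwFlipSequence T [] T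
  | cons {T S T' : G.ThreeOrientation} {t : Finset V} {l : List (Finset V)} :
      IsCcwFlip T t S → IsCcwFlipSequence S l T' → IsCcwFlipSequence T (t :: l) T'

/-- `l` is a sequence of facial flips that leads from `T` to `T'`. -/
def IsFacialFlipSequence (T : G.ThreeOrientation) (l : List (Finset V))
    (T' : G.ThreeOrientation) : Prop :=
  IsFlipSequence T l T' ∧ ∀ t ∈ l, G.IsFacial t

/-- `T₀` is the minimum 3-orientation for the order in which `T ≤ T'` means that `T` can be
obtained from `T'` by flips of counterclockwise triangles. -/
def IsMinimum (T₀ : G.ThreeOrientation) : Prop :=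
  ∀ T : G.ThreeOrientation, ∃ l, IsCcwFlipSequence T l T₀

/-- The (flip) potential: the number of occurrences of `t` in a sequence of flips of
counterclockwise triangles from `T` to the minimum 3-orientation. The number is the same for all
such sequences; formally we take the least one. -/
noncomputable def potential (T : G.ThreeOrientation) (t : Finset V) : ℕ :=
  sInf {k | ∃ T₀ l, IsMinimum T₀ ∧ IsCcwFlipSequence T l T₀ ∧ l.count t = k}

end ThreeOrientation

end PlaneTriangulation

/-! Flips of counterclockwise triangles form a transition system labelled by triangles. The main
point is that it has the diamond property in both directions (`IsCcwFlip.diamond`,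
`IsCcwFlip.diamond_symm`). The interior of a triangle with `k` inner vertices contains exactly `3k`
edges (`IsDirectedTriangle.card_region`), and the `k` vertices already need `3k` outgoing arcs. So
no arc enters the interior from the triangle (`ThreeOrientation.fst_mem_vint`), and distinct
directed counterclockwise triangles share no dart (`IsDirectedTriangle.eq_of_mem`). Any two paths
with the same start can then be completed to a common end, using only the labels missing from one or
the other (`IsStepPath.exchange`).

Termination and uniqueness of the sink come from heights. The difference of two 3-orientations is a
circulation, hence the boundary of an integer function on the faces (`exists_potential`), and a
counterclockwise flip lowers this function by one on the faces inside the triangle. If no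
counterclockwise triangle is directed, then no directed dual cut exists either
(`exists_ccw_triangle`), so the orientation lies below all others. By the exchange lemma the label
counts of a path to the minimum do not depend on the path.

A facial triangle is never separating, so facial flips preserve the potentials of separating
triangles. Conversely, exchange applied to the reversed paths from the minimum gives a common upper
bound `J` of both orientations, reached by flipping only triangles with different potentials
(`exists_join`). If the potentials agree on separating triangles, all these flips are facial, since
a counterclockwise directed triangle that bounds no face separates. The route up to `J` and down
again is a facial flip sequence; its length is at most twice the square of the number of faces.

All the planar topology is linear algebra over `ℚ`: ranks of incidence matrices give Euler
inequalities and the exactness that stands in for the Jordan curve theorem. -/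

set_option linter.unusedSectionVars false

namespace PlaneTriangulation

open scoped Classical in
noncomputable instance instFintypeDart {V : Type u} [Fintype V] (G : PlaneTriangulation V) :
    Fintype G.graph.Dart := inferInstance

noncomputable instance instFintypeFace {V : Type u} [Fintype V] (G : PlaneTriangulation V) :
    Fintype G.emb.Face :=
  have : Finite G.emb.Face := Quotient.finite _
  Fintype.ofFinite _

/-! ### Darts, faces and connectivity of the dual graph -/

section Basics

open scoped Classical

variable {V : Type u} [Fintype V] [DecidableEq V] (G : PlaneTriangulation V)

/-- The face on the left-hand side of a dart. -/
abbrev left (d : G.graph.Dart) : G.emb.Face := G.emb.leftFace d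

/-- The face on the right-hand side of a dart. -/
abbrev right (d : G.graph.Dart) : G.emb.Face := G.emb.leftFace d.symm

/-- The darts with a face of `S` on the left and a face outside `S` on the right. -/
def bd (S : Set G.emb.Face) : Set G.graph.Dart := {d | G.left d ∈ S ∧ G.right d ∉ S}

/-- The vertices that are surrounded by faces of `S`. -/
def vint (S : Set G.emb.Face) : Set V := {v | ∀ d : G.graph.Dart, d.fst = v → G.left d ∈ S}

variable {G}

theorem facePerm_apply (d : G.graph.Dart) : G.emb.facePerm d = G.emb.rot⁻¹ d.symm := rfl

theorem rot_inv_fst (d : G.graph.Dart) : (G.emb.rot⁻¹ d).fst = d.fst := by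
  have := G.emb.rot_fst (G.emb.rot⁻¹ d)
  simpa using this.symm

theorem facePerm_fst (d : G.graph.Dart) : (G.emb.facePerm d).fst = d.snd := by
  rw [facePerm_apply, rot_inv_fst]; rfl

theorem leftFace_eq_iff {d d' : G.graph.Dart} :
    G.left d = G.left d' ↔ G.emb.facePerm.SameCycle d d' := Quotient.eq

theorem left_facePerm (d : G.graph.Dart) : G.left (G.emb.facePerm d) = G.left d :=
  leftFace_eq_iff.2 (Equiv.Perm.sameCycle_apply_left.2 (Equiv.Perm.SameCycle.refl _ _))

theorem right_eq (d : G.graph.Dart) : G.right d = G.left (G.emb.rot⁻¹ d) := by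
  have := left_facePerm d.symm
  rw [facePerm_apply, SimpleGraph.Dart.symm_symm] at this
  exact this.symm

theorem right_rot (d : G.graph.Dart) : G.right (G.emb.rot d) = G.left d := by
  rw [right_eq]; simp

theorem right_symm (d : G.graph.Dart) : G.right d.symm = G.left d := by
  simp [right]

theorem facePerm_pow_three (d : G.graph.Dart) : (G.emb.facePerm ^ (3 : ℤ)) d = d := by
  have := G.triangular d
  simpa [zpow_ofNat, pow_succ] using this

theorem left_eq_left_iff {d d' : G.graph.Dart} : G.left d' = G.left d ↔
    d' = d ∨ d' = G.emb.facePerm d ∨ d' = G.emb.facePerm (G.emb.facePerm d) := by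
  constructor
  · intro h
    obtain ⟨i, rfl⟩ := leftFace_eq_iff.1 h.symm
    have h3 : (G.emb.facePerm ^ (3 * (i / 3))) d = d := by
      rw [zpow_mul]
      have : G.emb.facePerm ^ (3 : ℤ) = 1 := by
        ext1 e; exact facePerm_pow_three e
      simp [this]
    have hi : (G.emb.facePerm ^ i) d = (G.emb.facePerm ^ (i % 3)) d := by
      conv_lhs => rw [← Int.emod_add_mul_ediv i 3, zpow_add, Equiv.Perm.mul_apply, h3]
    rw [hi]
    have h0 := Int.emod_nonneg i (by norm_num : (3 : ℤ) ≠ 0)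
    have h1 := Int.emod_lt_of_pos i (by norm_num : (0 : ℤ) < 3)
    generalize i % 3 = j at *
    interval_cases j
    · simp
    · simp
    · right; right; simp [zpow_ofNat, pow_succ]
  · rintro (rfl | rfl | rfl) <;> simp [left_facePerm]

theorem facePerm_ne (d : G.graph.Dart) : G.emb.facePerm d ≠ d := by
  intro h
  have := facePerm_fst d
  rw [h] at this
  exact d.fst_ne_snd this

theorem facePerm_facePerm_ne (d : G.graph.Dart) : G.emb.facePerm (G.emb.facePerm d) ≠ d := by
  intro h
  have h3 := G.triangular d
  rw [h] at h3
  exact facePerm_ne d h3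

theorem facePerm_snd (d : G.graph.Dart) :
    (G.emb.facePerm d).snd = (G.emb.facePerm (G.emb.facePerm d)).fst := (facePerm_fst _).symm

theorem facePerm_facePerm_snd (d : G.graph.Dart) :
    (G.emb.facePerm (G.emb.facePerm d)).snd = d.fst := by
  rw [← facePerm_fst, G.triangular]

theorem exists_left_eq (f : G.emb.Face) : ∃ d, G.left d = f := Quotient.exists_rep f

theorem filter_left_eq (d : G.graph.Dart) :
    Finset.univ.filter (fun d' => G.left d' = G.left d) =
      {d, G.emb.facePerm d, G.emb.facePerm (G.emb.facePerm d)} := by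
  ext d'
  simp [left_eq_left_iff]

theorem card_filter_left_eq (f : G.emb.Face) :
    (Finset.univ.filter (fun d => G.left d = f)).card = 3 := by
  obtain ⟨d, rfl⟩ := exists_left_eq f
  rw [filter_left_eq, Finset.card_eq_three]
  exact ⟨_, _, _, (facePerm_ne d).symm, (facePerm_facePerm_ne d).symm, (facePerm_ne _).symm, rfl⟩

theorem card_filter_left_mem (S : Finset G.emb.Face) :
    (Finset.univ.filter (fun d => G.left d ∈ S)).card = 3 * S.card := by
  rw [Finset.card_eq_sum_card_fiberwise (f := G.left) (t := S)]
  · rw [Finset.sum_congr rfl (g := fun _ => 3), Finset.sum_const, smul_eq_mul, mul_comm]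
    intro f hf
    rw [← card_filter_left_eq f, Finset.filter_filter]
    congr 1
    ext d
    simp only [Finset.mem_filter, Finset.mem_univ, true_and, and_iff_right_iff_imp]
    rintro rfl; exact hf
  · intro d hd; simpa using hd

/-- A set of darts at the vertex `v` that is closed under rotation. -/
theorem forall_of_rot {P : G.graph.Dart → Prop} {d d' : G.graph.Dart} (h : d.fst = d'.fst)
    (hP : ∀ e, e.fst = d.fst → P e → P (G.emb.rot e)) (hd : P d) : P d' := by
  obtain ⟨i, hi⟩ := (G.emb.rot_cyclic d d' h).exists_nat_pow_eq
  rw [← hi]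
  clear hi
  have : ((G.emb.rot ^ i) d).fst = d.fst ∧ P ((G.emb.rot ^ i) d) := by
    induction i with
    | zero => exact ⟨rfl, hd⟩
    | succ i ih =>
      rw [pow_succ', Equiv.Perm.mul_apply]
      exact ⟨by rw [G.emb.rot_fst, ih.1], hP _ ih.1 ih.2⟩
  exact this.2

theorem exists_dart : ∃ d : G.graph.Dart, G.left d = G.outer := exists_left_eq _

theorem exists_dart_fst (v : V) : ∃ d : G.graph.Dart, d.fst = v := by
  obtain ⟨d, -⟩ := exists_dart (G := G)
  have : Nontrivial V := ⟨⟨d.fst, d.snd, d.fst_ne_snd⟩⟩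
  obtain ⟨w, hw⟩ := G.connected.preconnected.exists_adj_of_nontrivial v
  exact ⟨⟨(v, w), hw⟩, rfl⟩

theorem forall_of_adj {P : V → Prop} {v : V} (hv : P v)
    (h : ∀ d : G.graph.Dart, P d.fst → P d.snd) (w : V) : P w := by
  obtain ⟨p⟩ := G.connected.preconnected v w
  induction p with
  | nil => exact hv
  | cons hadj p ih => exact ih (h ⟨(_, _), hadj⟩ hv)

/-- The dual graph is connected. -/
theorem face_connected {A : Set G.emb.Face} (hA : A.Nonempty)
    (h : ∀ d, G.left d ∈ A → G.right d ∈ A) (f : G.emb.Face) : f ∈ A := by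
  -- Darts that are consecutive around a vertex have adjacent left faces, so `A` contains all faces
  -- around a vertex once it contains one. Connectedness of the graph spreads this from vertex to
  -- vertex.
  have hrot : ∀ e, G.left e ∈ A → G.left (G.emb.rot e) ∈ A := by
    intro e he
    have := right_rot e
    by_contra hc
    have h2 := h (G.emb.rot e).symm
    rw [right_symm] at h2
    refine hc (h2 ?_)
    change G.right (G.emb.rot e) ∈ A
    rwa [this]
  have hvert : ∀ d d' : G.graph.Dart, d.fst = d'.fst → G.left d ∈ A → G.left d' ∈ A := by
    intro d d' hdd hd
    exact forall_of_rot (P := fun e => G.left e ∈ A) hdd (fun e _ => hrot e) hd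
  obtain ⟨f₀, hf₀⟩ := hA
  obtain ⟨d₀, rfl⟩ := exists_left_eq f₀
  obtain ⟨d, rfl⟩ := exists_left_eq f
  refine forall_of_adj (G := G) (P := fun v => ∀ d : G.graph.Dart, d.fst = v → G.left d ∈ A)
    (v := d₀.fst) (fun d hd => hvert _ _ hd.symm hf₀) ?_ d.fst d rfl
  intro e he d hd
  exact hvert e.symm d hd.symm (h e (he e rfl))

theorem bd_nonempty {S : Set G.emb.Face} (h1 : S.Nonempty) (h2 : Sᶜ.Nonempty) :
    (G.bd S).Nonempty := by
  by_contra h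
  obtain ⟨f, hf⟩ := h2
  refine hf (face_connected h1 (fun d hd => ?_) f)
  by_contra hc
  exact h ⟨d, hd, hc⟩

theorem mem_bd_compl {S : Set G.emb.Face} {d : G.graph.Dart} :
    d ∈ G.bd Sᶜ ↔ d.symm ∈ G.bd S := by
  simp only [bd, Set.mem_compl_iff, Set.mem_ofPred_eq, right_symm, not_not]
  exact and_comm

/-- Net outflow at a vertex. -/
noncomputable def div {R : Type*} [AddCommGroup R] (x : G.graph.Dart → R) (v : V) : R :=
  ∑ d : G.graph.Dart, if d.fst = v then x d - x d.symm else 0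

/-- The right face of a dart is the left face of its predecessor in the rotation, so the sum around
`v` telescopes. -/
theorem div_face {R : Type*} [AddCommGroup R] (q : G.emb.Face → R) (v : V) :
    (∑ d : G.graph.Dart, if d.fst = v then q (G.left d) - q (G.right d) else 0) = 0 := by
  have h : (∑ d : G.graph.Dart, if d.fst = v then q (G.left d) else 0) =
      ∑ d : G.graph.Dart, if d.fst = v then q (G.right d) else 0 := by
    refine Finset.sum_equiv G.emb.rot (by simp) (fun d _ => ?_)
    rw [G.emb.rot_fst, right_rot]
  rw [← sub_eq_zero, ← Finset.sum_sub_distrib] at h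
  refine Eq.trans ?_ h
  refine Finset.sum_congr rfl (fun d _ => ?_)
  split_ifs <;> simp

theorem sum_symm {R : Type*} [AddCommMonoid R] (k : G.graph.Dart → R) :
    ∑ d : G.graph.Dart, k d.symm = ∑ d, k d :=
  Finset.sum_equiv (RotationSystem.dartReversal G.graph) (by simp) (fun _ _ => rfl)

theorem card_dart_euler :
    2 * Fintype.card V + 2 * Fintype.card G.emb.Face = Fintype.card G.graph.Dart + 4 := by
  have h1 := G.euler
  have h2 := G.graph.dart_card_eq_twice_card_edges
  rw [Nat.card_eq_fintype_card, Nat.card_eq_fintype_card, Nat.card_eq_fintype_card,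
    ← SimpleGraph.edgeFinset_card] at h1
  have h3 : Fintype.card G.graph.Dart = 2 * G.graph.edgeFinset.card := by
    rw [← h2]
  omega

theorem card_dart : Fintype.card G.graph.Dart = 3 * Fintype.card G.emb.Face := by
  have := card_filter_left_mem (G := G) Finset.univ
  simpa using this

end Basics

end PlaneTriangulation

namespace PlaneTriangulation

/-! ### Incidence matrices, Euler inequalities and exactness -/

section Homology

open scoped Classical

variable {V : Type u} [Fintype V] [DecidableEq V] {G : PlaneTriangulation V}

/-- Used to select one dart per edge as a row index; an arbitrary numbering of the vertices supplies
the choice. -/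
theorem exists_orientation (G : PlaneTriangulation V) :
    ∃ P : G.graph.Dart → Prop, ∀ d, P d.symm ↔ ¬ P d := by
  refine ⟨fun d => Fintype.equivFin V d.fst < Fintype.equivFin V d.snd, fun d => ?_⟩
  have : Fintype.equivFin V d.fst ≠ Fintype.equivFin V d.snd :=
    fun h => d.fst_ne_snd ((Fintype.equivFin V).injective h)
  change Fintype.equivFin V d.snd < Fintype.equivFin V d.fst ↔ _
  rw [not_lt]
  exact ⟨le_of_lt, fun h => lt_of_le_of_ne h this.symm⟩

theorem sum_filter_orientation {R : Type*} [AddCommMonoid R] {P : G.graph.Dart → Prop}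
    (hP : ∀ d, P d.symm ↔ ¬ P d) {D : Finset G.graph.Dart} (hD : ∀ d ∈ D, d.symm ∈ D)
    (k : G.graph.Dart → R) :
    ∑ d ∈ D.filter P, (k d + k d.symm) = ∑ d ∈ D, k d := by
  rw [Finset.sum_add_distrib, ← Finset.sum_filter_add_sum_filter_not D P]
  congr 1
  refine Finset.sum_bij (fun d _ => d.symm) ?_ ?_ ?_ ?_
  · intro d hd
    simp only [Finset.mem_filter] at hd ⊢
    exact ⟨hD d hd.1, by rw [hP]; simpa using hd.2⟩
  · intro d _ d' _ h
    simpa using congrArg SimpleGraph.Dart.symm h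
  · intro d hd
    simp only [Finset.mem_filter] at hd
    exact ⟨d.symm, by simpa [hP] using ⟨hD d hd.1, hd.2⟩, by simp⟩
  · intro d _; rfl

theorem card_filter_orientation {P : G.graph.Dart → Prop}
    (hP : ∀ d, P d.symm ↔ ¬ P d) {D : Finset G.graph.Dart} (hD : ∀ d ∈ D, d.symm ∈ D) :
    2 * (D.filter P).card = D.card := by
  have := sum_filter_orientation hP hD (fun _ => (1 : ℕ))
  simp only [Finset.sum_const, smul_eq_mul] at this
  omega

/-- Incidence matrix of darts and vertices. -/
def vertexMatrix (E : Finset G.graph.Dart) (W : Finset V) : Matrix E W ℚ :=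
  fun d w => (if d.1.fst = w then 1 else 0) - (if d.1.snd = w then 1 else 0)

/-- Incidence matrix of darts and faces. -/
noncomputable def faceMatrix (E : Finset G.graph.Dart) (S : Finset G.emb.Face) : Matrix E S ℚ :=
  fun d f => (if G.left d.1 = f then 1 else 0) - (if G.right d.1 = f then 1 else 0)

theorem sum_ite_coe {α : Type*} [DecidableEq α] (W : Finset α) (c : W → ℚ) (a : α) :
    ∑ w : W, (if a = w then (1 : ℚ) else 0) * c w = if h : a ∈ W then c ⟨a, h⟩ else 0 := by
  split_ifs with h
  · rw [Finset.sum_eq_single ⟨a, h⟩]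
    · simp
    · intro b _ hb
      rw [if_neg, zero_mul]
      rintro rfl; exact hb rfl
    · simp
  · refine Finset.sum_eq_zero (fun w _ => ?_)
    rw [if_neg, zero_mul]
    rintro rfl; exact h w.2

theorem vertexMatrix_mulVec (E : Finset G.graph.Dart) (W : Finset V) (c : W → ℚ) (d : E) :
    (vertexMatrix E W).mulVec c d = (if h : d.1.fst ∈ W then c ⟨_, h⟩ else 0) -
      (if h : d.1.snd ∈ W then c ⟨_, h⟩ else 0) := by
  simp only [Matrix.mulVec, dotProduct, vertexMatrix, sub_mul, Finset.sum_sub_distrib]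
  rw [← sum_ite_coe, ← sum_ite_coe]

theorem faceMatrix_mulVec (E : Finset G.graph.Dart) (S : Finset G.emb.Face) (c : S → ℚ) (d : E) :
    (faceMatrix E S).mulVec c d = (if h : G.left d.1 ∈ S then c ⟨_, h⟩ else 0) -
      (if h : G.right d.1 ∈ S then c ⟨_, h⟩ else 0) := by
  simp only [Matrix.mulVec, dotProduct, faceMatrix, sub_mul, Finset.sum_sub_distrib]
  rw [← sum_ite_coe, ← sum_ite_coe]

section

variable {P : G.graph.Dart → Prop} {D : Finset G.graph.Dart} {W : Finset V}
  {S : Finset G.emb.Face}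

/-- The boundary of a boundary vanishes, by `div_face`. The condition `hW` keeps the full rotation
at each vertex of `W`. -/
theorem vertexMatrix_mul_faceMatrix (hP : ∀ d, P d.symm ↔ ¬ P d) (hD : ∀ d ∈ D, d.symm ∈ D)
    (hW : ∀ d : G.graph.Dart, d.fst ∈ W → d ∈ D) :
    (vertexMatrix (D.filter P) W).transpose * faceMatrix (D.filter P) S = 0 := by
  ext w f
  simp only [Matrix.mul_apply, Matrix.transpose_apply, Matrix.zero_apply, vertexMatrix, faceMatrix]
  rw [Finset.sum_coe_sort (D.filter P) (fun d : G.graph.Dart =>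
    ((if d.fst = (w : V) then (1 : ℚ) else 0) - (if d.snd = (w : V) then 1 else 0)) *
    ((if G.left d = (f : G.emb.Face) then (1 : ℚ) else 0) -
      (if G.right d = (f : G.emb.Face) then 1 else 0)))]
  refine Eq.trans ?_ (div_face (fun g => if g = (f : G.emb.Face) then (1 : ℚ) else 0) (w : V))
  rw [← Finset.sum_subset (Finset.subset_univ D), ← sum_filter_orientation hP hD]
  · refine Finset.sum_congr rfl (fun d _ => ?_)
    rw [right_symm]
    have hs : d.symm.fst = d.snd := rfl
    have hr : G.left d.symm = G.right d := rfl
    rw [hs, hr]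
    generalize (if G.left d = (f : G.emb.Face) then (1 : ℚ) else 0) = a
    generalize (if G.right d = (f : G.emb.Face) then (1 : ℚ) else 0) = b
    split_ifs <;> ring
  · intro d _ hd
    rw [if_neg]
    intro h
    exact hd (hW d (h ▸ w.2))

/-- A kernel vector, extended by zero off `W`, is constant along edges; it vanishes at a vertex
outside `W`, hence everywhere by connectedness. -/
theorem rank_vertexMatrix (hP : ∀ d, P d.symm ↔ ¬ P d) (hD : ∀ d ∈ D, d.symm ∈ D)
    (hW : ∀ d : G.graph.Dart, d.fst ∈ W → d ∈ D) (hne : ∃ v, v ∉ W) :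
    (vertexMatrix (D.filter P) W).rank = W.card := by
  have hinj : Function.Injective (vertexMatrix (D.filter P) W).mulVecLin := by
    rw [← LinearMap.ker_eq_bot, LinearMap.ker_eq_bot']
    intro c hc
    obtain ⟨v, hv⟩ := hne
    let c' : V → ℚ := fun v => if h : v ∈ W then c ⟨v, h⟩ else 0
    have key : ∀ d ∈ D, c' d.fst = c' d.snd := by
      intro d hd
      by_cases hPd : P d
      · have := congrFun hc ⟨d, Finset.mem_filter.2 ⟨hd, hPd⟩⟩
        rw [Matrix.mulVecLin_apply, vertexMatrix_mulVec] at this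
        exact sub_eq_zero.1 this
      · have := congrFun hc ⟨d.symm, Finset.mem_filter.2 ⟨hD d hd, (hP d).2 hPd⟩⟩
        rw [Matrix.mulVecLin_apply, vertexMatrix_mulVec] at this
        exact (sub_eq_zero.1 this).symm
    have hz : ∀ w, c' w = 0 := by
      refine forall_of_adj (G := G) (v := v) (by simp [c', hv]) (fun d hd => ?_)
      by_cases h1 : d.fst ∈ W
      · rw [← key d (hW d h1), hd]
      · by_cases h2 : d.snd ∈ W
        · rw [← key d (by simpa using hD _ (hW d.symm h2)), hd]
        · simp [c', h2]
    ext w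
    have := hz w
    simpa [c'] using this
  rw [Matrix.rank, LinearMap.finrank_range_of_inj hinj]
  simp

/-- Kernel vectors are constant across the darts of `D`, hence constant on `S` by dual connectivity,
so the kernel has dimension at most one. -/
theorem rank_faceMatrix (hP : ∀ d, P d.symm ↔ ¬ P d) (hD : ∀ d ∈ D, d.symm ∈ D)
    (hS : ∀ d ∈ D, G.left d ∈ S)
    (hconn : ∀ A ⊆ S, A.Nonempty → (∀ d ∈ D, G.left d ∈ A → G.right d ∈ A) → A = S) :
    S.card ≤ (faceMatrix (D.filter P) S).rank + 1 := by
  have h := LinearMap.finrank_range_add_finrank_ker (faceMatrix (D.filter P) S).mulVecLin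
  rw [Module.finrank_fintype_fun_eq_card, Fintype.card_coe] at h
  have hker : Module.finrank ℚ (LinearMap.ker (faceMatrix (D.filter P) S).mulVecLin) ≤ 1 := by
    by_cases hne : S.Nonempty
    swap
    · rw [Finset.not_nonempty_iff_eq_empty] at hne
      rw [hne, Finset.card_empty] at h
      rw [hne]
      omega
    have hconst : ∀ q ∈ LinearMap.ker (faceMatrix (D.filter P) S).mulVecLin, ∀ f g, q f = q g := by
      intro q hq f g
      let q' : G.emb.Face → ℚ := fun f => if h : f ∈ S then q ⟨f, h⟩ else 0
      have key : ∀ d ∈ D, q' (G.left d) = q' (G.right d) := by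
        intro d hd
        rw [LinearMap.mem_ker] at hq
        by_cases hPd : P d
        · have := congrFun hq ⟨d, Finset.mem_filter.2 ⟨hd, hPd⟩⟩
          rw [Matrix.mulVecLin_apply, faceMatrix_mulVec] at this
          exact sub_eq_zero.1 this
        · have := congrFun hq ⟨d.symm, Finset.mem_filter.2 ⟨hD d hd, (hP d).2 hPd⟩⟩
          rw [Matrix.mulVecLin_apply, faceMatrix_mulVec] at this
          simp only [right_symm] at this
          exact (sub_eq_zero.1 this).symm
      have hA := hconn (S.filter (fun g => q' g = q' f)) (Finset.filter_subset _ _)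
        ⟨f, by simp⟩ (by
          intro d hd hl
          simp only [Finset.mem_filter] at hl ⊢
          exact ⟨hS _ (hD d hd), by rw [← key d hd, hl.2]⟩)
      have hg : (g : G.emb.Face) ∈ S.filter (fun g => q' g = q' f) := by rw [hA]; exact g.2
      have := (Finset.mem_filter.1 hg).2
      simpa [q'] using this.symm
    obtain ⟨f₀, hf₀⟩ := hne
    by_cases hv : ∃ v ∈ LinearMap.ker (faceMatrix (D.filter P) S).mulVecLin, v ⟨f₀, hf₀⟩ ≠ 0
    · obtain ⟨v, hv, hv0⟩ := hv
      refine finrank_le_one ⟨v, hv⟩ (fun w => ⟨w.1 ⟨f₀, hf₀⟩ / v ⟨f₀, hf₀⟩, ?_⟩)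
      ext g
      change _ / _ * v g = _
      rw [hconst _ hv g ⟨f₀, hf₀⟩, hconst _ w.2 g ⟨f₀, hf₀⟩, div_mul_cancel₀ _ hv0]
    · push Not at hv
      refine finrank_le_one 0 (fun w => ⟨0, ?_⟩)
      ext g
      rw [hconst _ w.2 g ⟨f₀, hf₀⟩, hv _ w.2]
      simp
  rw [Matrix.rank]
  omega

/-- Euler's inequality for a part of the triangulation with connected dual. -/
theorem euler_inequality (hD : ∀ d ∈ D, d.symm ∈ D) (hW : ∀ d : G.graph.Dart, d.fst ∈ W → d ∈ D)
    (hne : ∃ v, v ∉ W) (hS : ∀ d ∈ D, G.left d ∈ S)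
    (hconn : ∀ A ⊆ S, A.Nonempty → (∀ d ∈ D, G.left d ∈ A → G.right d ∈ A) → A = S) :
    2 * S.card + 2 * W.card ≤ D.card + 2 := by
  obtain ⟨P, hP⟩ := exists_orientation G
  have h1 := Matrix.rank_add_rank_le_card_of_mul_eq_zero
    (vertexMatrix_mul_faceMatrix (S := S) hP hD hW)
  rw [Matrix.rank_transpose, rank_vertexMatrix hP hD hW hne, Fintype.card_coe] at h1
  have h2 := rank_faceMatrix hP hD hS hconn
  have h3 := card_filter_orientation hP hD
  omega

end

/-- Boundaries of face functions are circulations, and Euler's formula makes the two dimensions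
agree. One vertex is left out of `W` to give the vertex matrix full rank. -/
theorem exists_potential_rat (y : G.graph.Dart → ℚ) (hy : ∀ d, y d.symm = - y d)
    (hdiv : ∀ v, (∑ d : G.graph.Dart, if d.fst = v then y d else 0) = 0) :
    ∃ q : G.emb.Face → ℚ, q G.outer = 0 ∧ ∀ d, y d = q (G.left d) - q (G.right d) := by
  obtain ⟨P, hP⟩ := exists_orientation G
  obtain ⟨d₀, -⟩ := exists_dart (G := G)
  set W : Finset V := Finset.univ.erase d₀.fst with hWdef
  have hD : ∀ d ∈ (Finset.univ : Finset G.graph.Dart), d.symm ∈ Finset.univ := by simp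
  have hW : ∀ d : G.graph.Dart, d.fst ∈ W → d ∈ Finset.univ := by simp
  have h0 := vertexMatrix_mul_faceMatrix (S := Finset.univ) hP hD hW
  have h1 := rank_vertexMatrix hP hD hW ⟨d₀.fst, by simp [W]⟩
  have h2 := rank_faceMatrix (S := Finset.univ) hP hD (by simp) (by
    intro A _ hA h
    ext f
    simpa using face_connected (A := (A : Set G.emb.Face)) hA (fun d hd => h d (by simp) hd) f)
  have h3 := card_filter_orientation hP hD
  set M := vertexMatrix (Finset.univ.filter P) W
  set N := faceMatrix (G := G) (Finset.univ.filter P) Finset.univ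
  have hle : LinearMap.range N.mulVecLin ≤ LinearMap.ker M.transpose.mulVecLin := by
    rintro _ ⟨q, rfl⟩
    simp only [LinearMap.mem_ker, Matrix.mulVecLin_apply, Matrix.mulVec_mulVec, h0,
      Matrix.zero_mulVec]
  have heq := Submodule.eq_of_le_of_finrank_le hle (by
    have h4 := LinearMap.finrank_range_add_finrank_ker M.transpose.mulVecLin
    change M.transpose.rank + _ = _ at h4
    rw [Matrix.rank_transpose, h1, Module.finrank_fintype_fun_eq_card, Fintype.card_coe,
      Finset.card_erase_of_mem (Finset.mem_univ _)] at h4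
    have h5 := G.card_dart_euler
    change _ ≤ N.rank
    simp only [Finset.card_univ] at *
    have : 0 < Fintype.card V := Fintype.card_pos_iff.2 ⟨d₀.fst⟩
    omega)
  have hmem : (fun d : Finset.univ.filter P => y d.1) ∈ LinearMap.ker M.transpose.mulVecLin := by
    rw [LinearMap.mem_ker]
    ext w
    simp only [Matrix.mulVecLin_apply, Matrix.mulVec, dotProduct, Matrix.transpose_apply,
      Pi.zero_apply, M, vertexMatrix]
    rw [Finset.sum_coe_sort (Finset.univ.filter P) (fun d : G.graph.Dart =>
      ((if d.fst = (w : V) then (1 : ℚ) else 0) - (if d.snd = (w : V) then 1 else 0)) * y d)]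
    refine Eq.trans ?_ (hdiv w)
    rw [← sum_filter_orientation hP hD]
    refine Finset.sum_congr rfl (fun d _ => ?_)
    rw [hy]
    change _ = _ + (if d.snd = (w : V) then _ else _)
    split_ifs <;> ring
  rw [← heq] at hmem
  obtain ⟨q, hq⟩ := hmem
  refine ⟨fun f => q ⟨f, by simp⟩ - q ⟨G.outer, by simp⟩, by simp, fun d => ?_⟩
  have key : ∀ d, P d → y d = q ⟨G.left d, by simp⟩ - q ⟨G.right d, by simp⟩ := by
    intro d hd
    have := congrFun hq ⟨d, by simpa using hd⟩
    rw [Matrix.mulVecLin_apply, faceMatrix_mulVec] at this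
    simpa using this.symm
  by_cases hd : P d
  · rw [key d hd]; ring
  · have h6 := key d.symm ((hP d).2 hd)
    rw [hy] at h6
    simp only [right_symm] at h6
    change -y d = q ⟨G.right d, by simp⟩ - q ⟨G.left d, by simp⟩ at h6
    linarith

/-- Every circulation is the boundary of a face potential. -/
theorem exists_potential (x : G.graph.Dart → ℤ) (hdiv : ∀ v, div x v = 0) :
    ∃ q : G.emb.Face → ℤ, q G.outer = 0 ∧
      ∀ d, x d - x d.symm = q (G.left d) - q (G.right d) := by
  obtain ⟨q, hq0, hq⟩ := exists_potential_rat (G := G) (fun d => ((x d - x d.symm : ℤ) : ℚ))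
    (by intro d; simp) (by
      intro v
      have := hdiv v
      rw [div] at this
      have h := congrArg (Int.cast : ℤ → ℚ) this
      rw [Int.cast_sum, Int.cast_zero] at h
      refine Eq.trans ?_ h
      refine Finset.sum_congr rfl (fun d _ => ?_)
      split_ifs <;> simp)
  -- The potential is zero at the outer face and jumps by integers across darts, so dual
  -- connectivity makes it integral.
  have hint : ∀ f, f ∈ {f | ∃ n : ℤ, q f = n} := by
    refine face_connected ⟨G.outer, 0, by simp [hq0]⟩ ?_
    rintro d ⟨n, hn⟩
    refine ⟨n - (x d - x d.symm), ?_⟩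
    have := hq d
    push_cast at this ⊢
    linarith
  choose p hp using hint
  refine ⟨p, ?_, fun d => ?_⟩
  · have := hp G.outer
    rw [hq0] at this
    exact_mod_cast this.symm
  · have := hq d
    rw [hp, hp] at this
    exact_mod_cast this

theorem potential_unique {p q : G.emb.Face → ℤ} (h0 : p G.outer = q G.outer)
    (h : ∀ d, p (G.left d) - p (G.right d) = q (G.left d) - q (G.right d)) : p = q := by
  ext f
  refine face_connected (A := {f | p f = q f}) ⟨G.outer, h0⟩ ?_ f
  intro d hd
  have := h d
  have h1 : p (G.left d) = q (G.left d) := hd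
  change p (G.right d) = q (G.right d)
  linarith

end Homology

end PlaneTriangulation

namespace PlaneTriangulation

/-! ### Triangles, their interiors and rigidity -/

section Triangles

open scoped Classical

variable {V : Type u} [Fintype V] [DecidableEq V] {G : PlaneTriangulation V}

/-- The set of the reversed darts. -/
def rev (C : Set G.graph.Dart) : Set G.graph.Dart := {d | d.symm ∈ C}

/-- The darts with faces of `S` on both sides. -/
def inn (G : PlaneTriangulation V) (S : Set G.emb.Face) : Set G.graph.Dart :=
  {d | G.left d ∈ S ∧ G.right d ∈ S}

/-- `S` is connected in the dual graph. -/
def IsConn (G : PlaneTriangulation V) (S : Set G.emb.Face) : Prop :=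
  ∀ A ⊆ S, A.Nonempty → (∀ d, G.left d ∈ A → G.right d ∈ S → G.right d ∈ A) → A = S

theorem mem_rev {C : Set G.graph.Dart} {d : G.graph.Dart} : d ∈ rev C ↔ d.symm ∈ C := Iff.rfl

theorem rev_rev (C : Set G.graph.Dart) : rev (rev C) = C := by
  ext d; simp [mem_rev]

theorem bd_compl (S : Set G.emb.Face) : G.bd Sᶜ = rev (G.bd S) := by
  ext d; exact mem_bd_compl

theorem rev_insert (d₁ d₂ d₃ : G.graph.Dart) :
    rev {d₁, d₂, d₃} = {d₁.symm, d₂.symm, d₃.symm} := by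
  ext d
  simp only [mem_rev, Set.mem_insert_iff, Set.mem_singleton_iff]
  have : ∀ e : G.graph.Dart, d.symm = e ↔ d = e.symm := by
    intro e
    constructor
    · rintro rfl; simp
    · rintro rfl; simp
  rw [this, this, this]

theorem dart_eq {d e : G.graph.Dart} (h1 : d.fst = e.fst) (h2 : d.snd = e.snd) : d = e := by
  ext
  · exact h1
  · exact h2

/-! ### Indicator functions -/

/-- Indicator function of a set of faces. -/
noncomputable def ind (S : Set G.emb.Face) (f : G.emb.Face) : ℤ := if f ∈ S then 1 else 0

theorem ind_sub (S : Set G.emb.Face) (d : G.graph.Dart) :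
    ind S (G.left d) - ind S (G.right d) =
      (if d ∈ G.bd S then 1 else 0) - (if d.symm ∈ G.bd S then 1 else 0) := by
  by_cases h1 : G.left d ∈ S <;> by_cases h2 : G.right d ∈ S <;>
    simp [ind, bd, right_symm, h1, h2]

theorem div_eq (x : G.graph.Dart → ℤ) (v : V) :
    div x v = ∑ d, x d * ((if d.fst = v then 1 else 0) - (if d.snd = v then 1 else 0)) := by
  have h : ∑ d : G.graph.Dart, (if d.fst = v then x d.symm else 0) =
      ∑ d : G.graph.Dart, if d.snd = v then x d else 0 := by
    rw [← sum_symm]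
    refine Finset.sum_congr rfl (fun d _ => ?_)
    rw [SimpleGraph.Dart.symm_symm]; rfl
  have h2 : div x v = ∑ d : G.graph.Dart, (if d.fst = v then x d else 0) -
      ∑ d : G.graph.Dart, (if d.fst = v then x d.symm else 0) := by
    rw [div, ← Finset.sum_sub_distrib]
    refine Finset.sum_congr rfl (fun d _ => ?_)
    split_ifs <;> simp
  rw [h2, h, ← Finset.sum_sub_distrib]
  refine Finset.sum_congr rfl (fun d _ => ?_)
  split_ifs <;> simp

theorem div_add (x y : G.graph.Dart → ℤ) (v : V) :
    div (fun d => x d + y d) v = div x v + div y v := by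
  simp only [div_eq, add_mul, Finset.sum_add_distrib]

/-! ### Directed triangles -/

/-- Three consecutive darts of a closed walk of length three. -/
def Tri (d₁ d₂ d₃ : G.graph.Dart) : Prop :=
  d₁.snd = d₂.fst ∧ d₂.snd = d₃.fst ∧ d₃.snd = d₁.fst

theorem Tri.rotate {d₁ d₂ d₃ : G.graph.Dart} (h : Tri d₁ d₂ d₃) : Tri d₂ d₃ d₁ :=
  ⟨h.2.1, h.2.2, h.1⟩

theorem Tri.reverse {d₁ d₂ d₃ : G.graph.Dart} (h : Tri d₁ d₂ d₃) :
    Tri d₁.symm d₃.symm d₂.symm := ⟨h.2.2.symm, h.2.1.symm, h.1.symm⟩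

theorem Tri.fst_ne {d₁ d₂ d₃ : G.graph.Dart} (h : Tri d₁ d₂ d₃) :
    d₁.fst ≠ d₂.fst ∧ d₂.fst ≠ d₃.fst ∧ d₁.fst ≠ d₃.fst := by
  refine ⟨?_, ?_, ?_⟩
  · rw [← h.1]; exact d₁.fst_ne_snd
  · rw [← h.2.1]; exact d₂.fst_ne_snd
  · rw [← h.2.2]; exact d₃.fst_ne_snd.symm

theorem isDirectedTriangle_iff {t : Finset V} {C : Set G.graph.Dart} :
    G.IsDirectedTriangle t C ↔ ∃ d₁ d₂ d₃, Tri d₁ d₂ d₃ ∧ C = {d₁, d₂, d₃} ∧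
      t = {d₁.fst, d₂.fst, d₃.fst} := by
  constructor
  · rintro ⟨d₁, d₂, d₃, h1, h2, h3, h⟩; exact ⟨d₁, d₂, d₃, ⟨h1, h2, h3⟩, h⟩
  · rintro ⟨d₁, d₂, d₃, ⟨h1, h2, h3⟩, h⟩; exact ⟨d₁, d₂, d₃, h1, h2, h3, h⟩

theorem exists_tri_of_mem {t : Finset V} {C : Set G.graph.Dart} (h : G.IsDirectedTriangle t C)
    {d : G.graph.Dart} (hd : d ∈ C) : ∃ d₂ d₃, Tri d d₂ d₃ ∧ C = {d, d₂, d₃} ∧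
      t = {d.fst, d₂.fst, d₃.fst} := by
  obtain ⟨d₁, d₂, d₃, htri, rfl, rfl⟩ := isDirectedTriangle_iff.1 h
  rcases hd with rfl | rfl | rfl
  · exact ⟨_, _, htri, rfl, rfl⟩
  · refine ⟨_, _, htri.rotate, ?_, ?_⟩ <;> ext <;> simp <;> tauto
  · refine ⟨_, _, htri.rotate.rotate, ?_, ?_⟩ <;> ext <;> simp <;> tauto

theorem isDirectedTriangle_rev {t : Finset V} {C : Set G.graph.Dart}
    (h : G.IsDirectedTriangle t C) : G.IsDirectedTriangle t (rev C) := by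
  obtain ⟨d₁, d₂, d₃, htri, rfl, rfl⟩ := isDirectedTriangle_iff.1 h
  refine isDirectedTriangle_iff.2 ⟨_, _, _, htri.reverse, ?_, ?_⟩
  · rw [rev_insert]; ext; simp; tauto
  · ext v
    simp only [Finset.mem_insert, Finset.mem_singleton]
    have e1 : d₁.symm.fst = d₂.fst := htri.1
    have e2 : d₂.symm.fst = d₃.fst := htri.2.1
    have e3 : d₃.symm.fst = d₁.fst := htri.2.2
    rw [e1, e2, e3]; tauto

theorem IsDirectedTriangle.symm_notMem {t : Finset V} {C : Set G.graph.Dart}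
    (h : G.IsDirectedTriangle t C) {d : G.graph.Dart} (hd : d ∈ C) : d.symm ∉ C := by
  obtain ⟨d₂, d₃, htri, rfl, rfl⟩ := exists_tri_of_mem h hd
  obtain ⟨h1, h2, h3⟩ := htri.fst_ne
  rintro (h' | h' | h')
  · exact d.symm_ne h'
  · have := congrArg (fun e : G.graph.Dart => e.snd) h'
    change d.fst = d₂.snd at this
    rw [htri.2.1] at this
    exact h3 this
  · have := congrArg (fun e : G.graph.Dart => e.fst) h'
    change d.snd = d₃.fst at this
    rw [htri.1] at this
    exact h2 this

theorem IsDirectedTriangle.nonempty {t : Finset V} {C : Set G.graph.Dart}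
    (h : G.IsDirectedTriangle t C) : C.Nonempty := by
  obtain ⟨d₁, d₂, d₃, htri, rfl, rfl⟩ := isDirectedTriangle_iff.1 h
  exact ⟨d₁, by simp⟩

theorem IsDirectedTriangle.fst_mem {t : Finset V} {C : Set G.graph.Dart}
    (h : G.IsDirectedTriangle t C) {d : G.graph.Dart} (hd : d ∈ C) : d.fst ∈ t ∧ d.snd ∈ t := by
  obtain ⟨d₂, d₃, htri, rfl, rfl⟩ := exists_tri_of_mem h hd
  simp [htri.1]

theorem IsDirectedTriangle.exists_fst {t : Finset V} {C : Set G.graph.Dart}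
    (h : G.IsDirectedTriangle t C) {v : V} (hv : v ∈ t) : ∃ d ∈ C, d.fst = v := by
  obtain ⟨d₁, d₂, d₃, htri, rfl, rfl⟩ := isDirectedTriangle_iff.1 h
  simp only [Finset.mem_insert, Finset.mem_singleton] at hv
  rcases hv with rfl | rfl | rfl
  · exact ⟨d₁, by simp, rfl⟩
  · exact ⟨d₂, by simp, rfl⟩
  · exact ⟨d₃, by simp, rfl⟩

theorem IsDirectedTriangle.ncard {t : Finset V} {C : Set G.graph.Dart}
    (h : G.IsDirectedTriangle t C) : C.ncard = 3 ∧ t.card = 3 := by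
  obtain ⟨d₁, d₂, d₃, htri, rfl, rfl⟩ := isDirectedTriangle_iff.1 h
  obtain ⟨h1, h2, h3⟩ := htri.fst_ne
  constructor
  · rw [Set.ncard_eq_three]
    refine ⟨_, _, _, ?_, ?_, ?_, rfl⟩ <;> rintro rfl <;> contradiction
  · rw [Finset.card_eq_three]
    exact ⟨_, _, _, h1, h3, h2, rfl⟩

/-- At the common vertex of `d₁` and `d₂` no other edge carries flow, so what arrives along one
leaves along the other. -/
theorem Tri.apply_eq {d₁ d₂ d₃ : G.graph.Dart} (h : Tri d₁ d₂ d₃) {y : G.graph.Dart → ℤ}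
    (hy : ∀ d, y d.symm = - y d)
    (hdiv : ∀ v, (∑ d : G.graph.Dart, if d.fst = v then y d else 0) = 0)
    (hsupp : ∀ d, y d ≠ 0 → d ∈ ({d₁, d₂, d₃} : Set G.graph.Dart) ∨
      d.symm ∈ ({d₁, d₂, d₃} : Set G.graph.Dart)) : y d₁ = y d₂ := by
  obtain ⟨h1, h2, h3⟩ := h.fst_ne
  have hv := hdiv d₂.fst
  rw [Finset.sum_eq_add d₁.symm d₂] at hv
  · rw [if_pos (show d₁.symm.fst = d₂.fst from h.1), if_pos rfl, hy] at hv
    linarith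
  · intro hc
    have := congrArg (fun e : G.graph.Dart => e.snd) hc
    change d₁.fst = d₂.snd at this
    rw [h.2.1] at this
    exact h3 this
  · rintro d - ⟨hd1, hd2⟩
    split_ifs with hd
    swap; · rfl
    by_contra hc
    rcases hsupp d hc with (rfl | rfl | rfl) | (h' | h' | h')
    · exact h1 hd
    · exact hd2 rfl
    · exact h2 hd.symm
    · exact hd1 (by rw [← h']; simp)
    · have h4 : d.symm.snd = d₂.fst := hd
      rw [h'] at h4
      exact d₂.fst_ne_snd h4.symm
    · have h4 : d.symm.snd = d₂.fst := hd
      rw [h', h.2.2] at h4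
      exact h1 h4
  · simp
  · simp

/-- A cut supported on a triangle consists of the triangle or is empty. -/
theorem IsDirectedTriangle.cut {t : Finset V} {C : Set G.graph.Dart}
    (h : G.IsDirectedTriangle t C) {A : Set G.emb.Face}
    (hA : ∀ d ∈ G.bd A, d ∈ C ∨ d.symm ∈ C) :
    G.bd A = C ∨ G.bd A = rev C ∨ G.bd A = ∅ := by
  have hC := h
  obtain ⟨d₁, d₂, d₃, htri, rfl, rfl⟩ := isDirectedTriangle_iff.1 h
  set C : Set G.graph.Dart := {d₁, d₂, d₃} with hCdef
  set y : G.graph.Dart → ℤ := fun d => ind A (G.left d) - ind A (G.right d) with hydef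
  have hy : ∀ d, y d.symm = - y d := by
    intro d; simp only [hydef, right_symm]; change ind A (G.right d) - _ = _; ring
  have hdiv : ∀ v, (∑ d : G.graph.Dart, if d.fst = v then y d else 0) = 0 := div_face (ind A)
  have hval : ∀ d, y d = (if d ∈ G.bd A then 1 else 0) - (if d.symm ∈ G.bd A then 1 else 0) :=
    fun d => ind_sub A d
  have hsupp : ∀ d, y d ≠ 0 → d ∈ C ∨ d.symm ∈ C := by
    intro d hd
    by_cases h1 : d ∈ G.bd A
    · exact hA d h1
    · by_cases h2 : d.symm ∈ G.bd A
      · have := hA _ h2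
        rw [SimpleGraph.Dart.symm_symm] at this
        exact this.symm
      · rw [hval, if_neg h1, if_neg h2] at hd
        exact absurd rfl hd
  have e1 := htri.apply_eq hy hdiv hsupp
  have e2 := htri.rotate.apply_eq hy hdiv (fun d hd => by
    have := hsupp d hd
    simp only [hCdef, Set.mem_insert_iff, Set.mem_singleton_iff] at this ⊢
    tauto)
  -- The flow is one constant along the triangle; its values `1`, `-1` and `0` correspond to the
  -- three alternatives.
  have hconst : ∀ d ∈ C, y d = y d₁ := by
    rintro d (rfl | rfl | rfl)
    · rfl
    · exact e1.symm
    · rw [e1, e2]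
  have hmem : ∀ d, d ∈ G.bd A ↔ y d = 1 := by
    intro d
    have : ¬ (d ∈ G.bd A ∧ d.symm ∈ G.bd A) := fun hh => hh.1.2 hh.2.1
    rw [hval]
    by_cases h1 : d ∈ G.bd A <;> by_cases h2 : d.symm ∈ G.bd A <;> simp_all
  have hmem' : ∀ d, d.symm ∈ G.bd A ↔ y d = -1 := by
    intro d
    rw [hmem, hy]
    constructor <;> intro h <;> linarith
  by_cases h1 : y d₁ = 1
  · left
    ext d
    rw [hmem]
    refine ⟨fun hd => ?_, fun hd => by rw [hconst d hd, h1]⟩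
    rcases hsupp d (by rw [hd]; simp) with h | h
    · exact h
    · have := hconst _ h
      rw [hy, h1, hd] at this
      norm_num at this
  · by_cases h2 : y d₁ = -1
    · right; left
      ext d
      rw [hmem, mem_rev]
      constructor
      · intro hd
        rcases hsupp d (by rw [hd]; simp) with h | h
        · have := hconst _ h
          rw [h2, hd] at this
          norm_num at this
        · exact h
      · intro hd
        have := hconst _ hd
        rw [hy, h2] at this
        linarith
    · right; right
      ext d
      simp only [Set.mem_empty_iff_false, iff_false]
      intro hd
      rcases hA d hd with h | h
      · exact h1 (by rw [← hconst _ h, ← hmem]; exact hd)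
      · refine h2 ?_
        rw [← hconst _ h, ← hmem', SimpleGraph.Dart.symm_symm]
        exact hd

theorem bd_eq_empty {A : Set G.emb.Face} (h : G.bd A = ∅) : A = ∅ ∨ A = Set.univ := by
  by_contra hc
  push Not at hc
  have := bd_nonempty (G := G) hc.1 (Set.nonempty_compl.2 hc.2)
  rw [h] at this
  exact Set.not_nonempty_empty this

theorem isCounterclockwise_iff {C : Set G.graph.Dart} :
    G.IsCounterclockwise C ↔ ∃ S : Set G.emb.Face, G.outer ∉ S ∧ C = G.bd S := by
  constructor
  · rintro ⟨S, h1, h2⟩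
    exact ⟨S, h1, Set.ext h2⟩
  · rintro ⟨S, h1, rfl⟩
    exact ⟨S, h1, fun d => Iff.rfl⟩

theorem IsDirectedTriangle.div_indicator {t : Finset V} {C : Set G.graph.Dart}
    (h : G.IsDirectedTriangle t C) (v : V) :
    div (fun d => if d ∈ C then (1 : ℤ) else 0) v = 0 := by
  obtain ⟨d₁, d₂, d₃, htri, rfl, rfl⟩ := isDirectedTriangle_iff.1 h
  obtain ⟨h1, h2, h3⟩ := htri.fst_ne
  rw [div_eq]
  simp only [ite_mul, one_mul, zero_mul]
  rw [← Finset.sum_filter]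
  have : Finset.univ.filter (fun d => d ∈ ({d₁, d₂, d₃} : Set G.graph.Dart)) = {d₁, d₂, d₃} := by
    ext d; simp
  rw [this, Finset.sum_insert, Finset.sum_insert, Finset.sum_singleton, htri.1, htri.2.1, htri.2.2]
  · ring
  · simp only [Finset.mem_singleton]; rintro rfl; contradiction
  · simp only [Finset.mem_insert, Finset.mem_singleton]
    rintro (rfl | rfl) <;> contradiction

/-- A superlevel set of `q` at a positive level excludes the outer face, and its boundary lies in
`C`. By `IsDirectedTriangle.cut` that boundary is all of `C`. -/
theorem IsDirectedTriangle.isCounterclockwise_of_pos {t : Finset V} {C : Set G.graph.Dart}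
    (h : G.IsDirectedTriangle t C) {q : G.emb.Face → ℤ} (h0 : q G.outer = 0)
    (hq : ∀ d, (if d ∈ C then 1 else 0) - (if d.symm ∈ C then 1 else 0) =
      q (G.left d) - q (G.right d)) {f : G.emb.Face} (hf : 1 ≤ q f) :
    G.IsCounterclockwise C := by
  have hsub : G.bd {g | q f ≤ q g} ⊆ C := by
    rintro d ⟨h1, h2⟩
    simp only [Set.mem_ofPred_eq, not_le] at h1 h2
    by_contra hc
    have := hq d
    rw [if_neg hc] at this
    split_ifs at this <;> linarith
  have ho : G.outer ∉ {g | q f ≤ q g} := by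
    simp only [Set.mem_ofPred_eq, not_le, h0]; omega
  rcases h.cut (fun d hd => Or.inl (hsub hd)) with h1 | h1 | h1
  · exact isCounterclockwise_iff.2 ⟨_, ho, h1.symm⟩
  · obtain ⟨d, hd⟩ := h.nonempty
    have h2 := hsub (h1 ▸ (show d.symm ∈ rev C by simpa [mem_rev] using hd))
    exact absurd h2 (h.symm_notMem hd)
  · rcases bd_eq_empty h1 with h2 | h2
    · have : f ∈ {g | q f ≤ q g} := le_refl (q f)
      rw [h2] at this
      exact absurd this (Set.notMem_empty _)
    · exact absurd (h2 ▸ Set.mem_univ G.outer) ho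

/-- The Jordan curve theorem for triangles. -/
theorem IsDirectedTriangle.isCounterclockwise_or {t : Finset V} {C : Set G.graph.Dart}
    (h : G.IsDirectedTriangle t C) : G.IsCounterclockwise C ∨ G.IsCounterclockwise (rev C) := by
  obtain ⟨q, h0, hq⟩ := exists_potential _ h.div_indicator
  obtain ⟨d, hd⟩ := h.nonempty
  have hd' := hq d
  rw [if_pos hd, if_neg (h.symm_notMem hd)] at hd'
  by_cases h1 : 1 ≤ q (G.left d)
  · exact Or.inl (h.isCounterclockwise_of_pos h0 hq h1)
  · refine Or.inr ((isDirectedTriangle_rev h).isCounterclockwise_of_pos (q := fun f => - q f)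
      (by simp [h0]) (fun d => ?_) (f := G.right d) (by linarith))
    have := hq d
    simp only [mem_rev, SimpleGraph.Dart.symm_symm]
    linarith

/-! ### Regions -/

/-- The boundary of a dual component `A` of `S` lies in the triangle, hence is empty or the whole
triangle. In the latter case nothing is left to bound `S \ A`. -/
theorem IsDirectedTriangle.isConn {t : Finset V} {C : Set G.graph.Dart}
    (h : G.IsDirectedTriangle t C) {S : Set G.emb.Face} (hS : G.bd S = C) : G.IsConn S := by
  intro A hAS hA hcl
  have hsub : G.bd A ⊆ C := by
    rintro d ⟨h1, h2⟩
    rw [← hS]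
    exact ⟨hAS h1, fun hc => h2 (hcl d h1 hc)⟩
  have huniv : G.bd A = ∅ → A = S := by
    intro h1
    rcases bd_eq_empty h1 with h2 | h2
    · exact absurd h2 hA.ne_empty
    · exact hAS.antisymm (by simp [h2])
  rcases h.cut (fun d hd => Or.inl (hsub hd)) with h1 | h1 | h1
  · have hB : G.bd (S \ A) = ∅ := by
      ext d
      simp only [Set.mem_empty_iff_false, iff_false]
      rintro ⟨⟨h2, h3⟩, h4⟩
      by_cases h5 : G.right d ∈ S
      · have h6 : G.right d ∈ A := by
          by_contra h7; exact h4 ⟨h5, h7⟩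
        have := hcl d.symm h6 (by rw [right_symm]; exact h2)
        rw [right_symm] at this
        exact h3 this
      · have : d ∈ G.bd A := by rw [h1, ← hS]; exact ⟨h2, h5⟩
        exact h3 this.1
    rcases bd_eq_empty hB with h2 | h2
    · exact hAS.antisymm (Set.sdiff_eq_empty.1 h2)
    · obtain ⟨f, hf⟩ := hA
      have := h2 ▸ Set.mem_univ f
      exact absurd hf this.2
  · obtain ⟨d, hd⟩ := h.nonempty
    have h2 := hsub (h1 ▸ (show d.symm ∈ rev C by simpa [mem_rev] using hd))
    exact absurd h2 (h.symm_notMem hd)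
  · exact huniv h1

theorem mem_inn_of_vint {S : Set G.emb.Face} {d : G.graph.Dart} (h : d.fst ∈ G.vint S) :
    d ∈ G.inn S := by
  refine ⟨h d rfl, ?_⟩
  rw [right_eq]
  exact h _ (rot_inv_fst d)

theorem symm_mem_inn {S : Set G.emb.Face} {d : G.graph.Dart} :
    d.symm ∈ G.inn S ↔ d ∈ G.inn S := by
  simp only [inn, Set.mem_ofPred_eq, right_symm]
  exact and_comm

theorem fst_notMem_vint {S : Set G.emb.Face} {d : G.graph.Dart} (h : d ∈ G.bd S) :
    d.fst ∉ G.vint S ∧ d.snd ∉ G.vint S := by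
  refine ⟨fun h1 => h.2 (mem_inn_of_vint h1).2, fun h1 => h.2 ?_⟩
  exact (mem_inn_of_vint (d := d.symm) h1).1

theorem vint_or {S : Set G.emb.Face} {v : V}
    (h : ∀ d : G.graph.Dart, d.fst = v → d ∉ G.bd S ∧ d.symm ∉ G.bd S) :
    v ∈ G.vint S ∨ v ∈ G.vint Sᶜ := by
  obtain ⟨d, hd⟩ := exists_dart_fst (G := G) v
  have hstep : ∀ e : G.graph.Dart, e.fst = v → (G.left (G.emb.rot e) ∈ S ↔ G.left e ∈ S) := by
    intro e he
    have := h (G.emb.rot e) (by rw [G.emb.rot_fst, he])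
    simp only [bd, Set.mem_ofPred_eq, right_symm, right_rot] at this
    tauto
  by_cases hl : G.left d ∈ S
  · left
    intro d' hd'
    exact forall_of_rot (P := fun e => G.left e ∈ S) (hd.trans hd'.symm)
      (fun e he h1 => (hstep e (he.trans hd)).2 h1) hl
  · right
    intro d' hd'
    exact forall_of_rot (P := fun e => G.left e ∉ S) (hd.trans hd'.symm)
      (fun e he h1 => by rwa [hstep e (he.trans hd)]) hl

theorem card_inn_add_card_bd (S : Set G.emb.Face) :
    (G.inn S).ncard + (G.bd S).ncard = 3 * S.ncard := by
  have h := card_filter_left_mem (G := G) S.toFinset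
  rw [← Set.ncard_eq_toFinset_card'] at h
  rw [← h, ← Set.ncard_union_eq]
  · rw [← Set.ncard_coe_finset]
    congr 1
    ext d
    simp [inn, bd]
    tauto
  · rw [Set.disjoint_left]
    rintro d ⟨_, h1⟩ ⟨_, h2⟩
    exact h2 h1

theorem IsConn.euler {S : Set G.emb.Face} (h : G.IsConn S) (hS : Sᶜ.Nonempty) :
    2 * S.ncard + 2 * (G.vint S).ncard ≤ (G.inn S).ncard + 2 := by
  have := euler_inequality (G := G) (D := (G.inn S).toFinset) (W := (G.vint S).toFinset)
    (S := S.toFinset) ?_ ?_ ?_ ?_ ?_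
  · simpa only [← Set.ncard_eq_toFinset_card'] using this
  · intro d; simp [symm_mem_inn]
  · intro d; simpa using mem_inn_of_vint
  · obtain ⟨f, hf⟩ := hS
    obtain ⟨d, rfl⟩ := exists_left_eq f
    refine ⟨d.fst, ?_⟩
    simp only [Set.mem_toFinset]
    exact fun h => hf (h d rfl)
  · intro d; simp only [Set.mem_toFinset]; exact fun h => h.1
  · intro A hA hne hcl
    have := h (A : Set G.emb.Face) (by intro f hf; simpa using hA hf) hne (fun d h1 h2 => by
      refine hcl d ?_ h1
      simp only [Set.mem_toFinset]
      exact ⟨by simpa using hA h1, h2⟩)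
    rw [← Finset.coe_inj, this]; simp

theorem card_face : Fintype.card G.emb.Face + 4 = 2 * Fintype.card V := by
  have h1 := G.card_dart_euler
  have h2 := G.card_dart
  omega

theorem IsDirectedTriangle.notMem_vint {t : Finset V} {C : Set G.graph.Dart}
    (h : G.IsDirectedTriangle t C) {S : Set G.emb.Face} (hS : G.bd S = C) {v : V} (hv : v ∈ t) :
    v ∉ G.vint S ∧ v ∉ G.vint Sᶜ := by
  obtain ⟨d, hd, rfl⟩ := h.exists_fst hv
  rw [← hS] at hd
  refine ⟨(fst_notMem_vint hd).1, ?_⟩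
  have : d.symm ∈ G.bd Sᶜ := by rw [mem_bd_compl]; simpa using hd
  exact (fst_notMem_vint this).2

theorem IsDirectedTriangle.vint_or {t : Finset V} {C : Set G.graph.Dart}
    (h : G.IsDirectedTriangle t C) {S : Set G.emb.Face} (hS : G.bd S = C) {v : V} (hv : v ∉ t) :
    v ∈ G.vint S ∨ v ∈ G.vint Sᶜ := by
  refine PlaneTriangulation.vint_or (fun d hd => ?_)
  rw [hS]
  exact ⟨fun h1 => hv (hd ▸ (h.fst_mem h1).1), fun h1 => hv (hd ▸ (h.fst_mem h1).2)⟩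

theorem disjoint_vint (S : Set G.emb.Face) : Disjoint (G.vint S) (G.vint Sᶜ) := by
  rw [Set.disjoint_left]
  intro v h1 h2
  obtain ⟨d, hd⟩ := exists_dart_fst (G := G) v
  exact h2 d hd (h1 d hd)

/-- Euler's inequality gives at least `2k + 1` faces on each side, with `k` the number of interior
vertices of that side. The total number of faces attains the sum of these bounds, so both are tight.
-/
theorem IsDirectedTriangle.card_region {t : Finset V} {C : Set G.graph.Dart}
    (h : G.IsDirectedTriangle t C) {S : Set G.emb.Face} (hS : G.bd S = C) :
    S.ncard = 2 * (G.vint S).ncard + 1 ∧ (G.inn S).ncard = 6 * (G.vint S).ncard := by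
  obtain ⟨d, hd⟩ := h.nonempty
  rw [← hS] at hd
  have e1 := (h.isConn hS).euler ⟨_, hd.2⟩
  have hS' : G.bd Sᶜ = rev C := by rw [bd_compl, hS]
  have e2 := ((isDirectedTriangle_rev h).isConn hS').euler ⟨G.left d, by simpa using hd.1⟩
  have e3 := card_inn_add_card_bd S
  have e4 := card_inn_add_card_bd Sᶜ
  rw [hS, h.ncard.1] at e3
  rw [hS', (isDirectedTriangle_rev h).ncard.1] at e4
  have e5 := Set.ncard_add_ncard_compl S
  rw [Nat.card_eq_fintype_card] at e5
  have e6 := card_face (G := G)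
  have e7 : (G.vint S).ncard + (G.vint Sᶜ).ncard + 3 = Fintype.card V := by
    rw [← Set.ncard_union_eq (disjoint_vint S), ← h.ncard.2, ← Set.ncard_coe_finset,
      ← Set.ncard_union_eq, ← Nat.card_eq_fintype_card, ← Set.ncard_univ]
    · congr 1
      ext v
      simp only [Set.mem_union, Finset.mem_coe, Set.mem_univ, iff_true]
      by_cases hv : v ∈ t
      · exact Or.inr hv
      · exact Or.inl (h.vint_or hS hv)
    · rw [Set.disjoint_left]
      rintro v (h1 | h1) h2
      · exact (h.notMem_vint hS h2).1 h1
      · exact (h.notMem_vint hS h2).2 h1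
  omega

/-! ### Rigidity -/

theorem IsOuterDart.symm {d : G.graph.Dart} (h : G.IsOuterDart d) : G.IsOuterDart d.symm := by
  unfold IsOuterDart at *
  rw [SimpleGraph.Dart.symm_symm]
  exact Or.symm h

theorem not_isOuterDart_of_inn {S : Set G.emb.Face} (hS : G.outer ∉ S) {d : G.graph.Dart}
    (h : d ∈ G.inn S) : ¬ G.IsOuterDart d := by
  rintro (h1 | h1)
  · exact hS (h1 ▸ h.1)
  · exact hS (h1 ▸ h.2)

theorem not_isOuterVertex_of_vint {S : Set G.emb.Face} (hS : G.outer ∉ S) {v : V}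
    (h : v ∈ G.vint S) : ¬ G.IsOuterVertex v := by
  rintro ⟨d, h1, h2⟩
  exact hS (h1 ▸ h d h2)

namespace ThreeOrientation

theorem card_arcs_fst_mem (T : G.ThreeOrientation) {Y : Set V}
    (hY : ∀ v ∈ Y, ¬ G.IsOuterVertex v) : {d ∈ T.arcs | d.fst ∈ Y}.ncard = 3 * Y.ncard := by
  rw [Set.ncard_eq_toFinset_card', Set.ncard_eq_toFinset_card',
    Finset.card_eq_sum_card_fiberwise (f := fun d => d.fst) (t := Y.toFinset)]
  · rw [Finset.sum_congr rfl (g := fun _ => 3), Finset.sum_const, smul_eq_mul, mul_comm]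
    intro v hv
    have := T.inner_vertex v (hY v (by simpa using hv))
    rw [Set.ncard_eq_toFinset_card'] at this
    rw [← this]
    congr 1
    ext d
    simp only [Finset.mem_filter, Set.mem_toFinset, Set.mem_ofPred_eq]
    constructor
    · rintro ⟨⟨h1, _⟩, h2⟩; exact ⟨h1, h2⟩
    · rintro ⟨h1, rfl⟩; exact ⟨⟨h1, by simpa using hv⟩, rfl⟩
  · intro d hd; simp at hd; simpa using hd.2

theorem card_arcs_of_symm (T : G.ThreeOrientation) {D : Set G.graph.Dart}
    (hD : ∀ d ∈ D, d.symm ∈ D) (hin : ∀ d ∈ D, ¬ G.IsOuterDart d) :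
    2 * (T.arcs ∩ D).ncard = D.ncard := by
  have h1 : (D \ T.arcs).ncard = (T.arcs ∩ D).ncard := by
    refine Set.ncard_congr (fun d _ => d.symm) ?_ ?_ ?_
    · rintro d ⟨h1, h2⟩
      refine ⟨?_, hD d h1⟩
      by_contra h3
      exact h2 ((T.inner_edge d (hin d h1)).2 h3)
    · intro d d' _ _ h
      simpa using congrArg SimpleGraph.Dart.symm h
    · rintro d ⟨h1, h2⟩
      exact ⟨d.symm, ⟨hD d h2, (T.inner_edge d (hin d h2)).1 h1⟩, by simp⟩
  have h2 := Set.ncard_inter_add_ncard_sdiff_eq_ncard D T.arcs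
  rw [Set.inter_comm] at h2
  omega

/-- No edge in the interior of a triangle points away from the triangle. -/
theorem fst_mem_vint (T : G.ThreeOrientation) {t : Finset V} {C : Set G.graph.Dart}
    (h : G.IsDirectedTriangle t C) {S : Set G.emb.Face} (hS : G.bd S = C) (ho : G.outer ∉ S)
    {d : G.graph.Dart} (hd : d ∈ T.arcs) (hdS : d ∈ G.inn S) : d.fst ∈ G.vint S := by
  have h1 := (h.card_region hS).2
  have h2 := T.card_arcs_of_symm (D := G.inn S) (fun d hd => symm_mem_inn.2 hd)
    (fun d hd => not_isOuterDart_of_inn ho hd)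
  have h3 := T.card_arcs_fst_mem (Y := G.vint S) (fun v hv => not_isOuterVertex_of_vint ho hv)
  -- The arcs leaving interior vertices are as many as the edges inside, so they account for all
  -- arcs inside.
  have h4 : {d ∈ T.arcs | d.fst ∈ G.vint S} = T.arcs ∩ G.inn S := by
    refine Set.eq_of_subset_of_ncard_le ?_ (by omega)
    rintro d ⟨h4, h5⟩
    exact ⟨h4, mem_inn_of_vint h5⟩
  have : d ∈ T.arcs ∩ G.inn S := ⟨hd, hdS⟩
  rw [← h4] at this
  exact this.2

end ThreeOrientation

theorem Tri.eq_of_apex {d d₂ d₃ e₂ e₃ : G.graph.Dart} (h : Tri d d₂ d₃) (h' : Tri d e₂ e₃)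
    (he : d₃.fst = e₃.fst) : d₂ = e₂ ∧ d₃ = e₃ :=
  ⟨dart_eq (h.1.symm.trans h'.1) (h.2.1.trans (he.trans h'.2.1.symm)),
    dart_eq he (h.2.2.trans h'.2.2.symm)⟩

/-- A dual walk inside `S` that starts next to `d` could leave `S'` only across `d`, which bounds
`S`, or across an edge at the apex, around which there are no faces of `S`. -/
theorem subset_of_apex_exterior {d e₂ e₃ : G.graph.Dart} (h' : Tri d e₂ e₃)
    {S S' : Set G.emb.Face} (hconn : G.IsConn S) (hS' : G.bd S' = {d, e₂, e₃})
    (hd : d ∈ G.bd S) (hc : e₃.fst ∈ G.vint Sᶜ) : S ⊆ S' := by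
  have hd' : d ∈ G.bd S' := by rw [hS']; simp
  have := hconn (S ∩ S') Set.inter_subset_left ⟨_, hd.1, hd'.1⟩ (by
    rintro e ⟨h1, h2⟩ h3
    refine ⟨h3, ?_⟩
    by_contra h4
    have he : e ∈ G.bd S' := ⟨h2, h4⟩
    rw [hS'] at he
    rcases he with rfl | rfl | rfl
    · exact hd.2 h3
    · have : e.symm.fst ∈ G.vint Sᶜ := by
        have : e.symm.fst = e₃.fst := h'.2.1
        rwa [this]
      exact (mem_inn_of_vint this).2 (by rw [right_symm]; exact h1)
    · exact (mem_inn_of_vint hc).1 h1)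
  exact Set.inter_eq_left.1 this

/-- Otherwise `e₂` would be an arc from a vertex of the triangle into its interior, against
`ThreeOrientation.fst_mem_vint`. -/
theorem not_apex_interior {d d₂ d₃ e₂ e₃ : G.graph.Dart} (h : Tri d d₂ d₃) (h' : Tri d e₂ e₃)
    {S : Set G.emb.Face} (hS : G.bd S = {d, d₂, d₃}) (ho : G.outer ∉ S) {T : G.ThreeOrientation}
    (hT : e₂ ∈ T.arcs) : e₃.fst ∉ G.vint S := by
  intro hc
  have h1 : e₂.symm ∈ G.inn S := mem_inn_of_vint (by
    have : e₂.symm.fst = e₃.fst := h'.2.1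
    rwa [this])
  have ht : G.IsDirectedTriangle {d.fst, d₂.fst, d₃.fst} {d, d₂, d₃} :=
    isDirectedTriangle_iff.2 ⟨_, _, _, h, rfl, rfl⟩
  have h2 := T.fst_mem_vint ht hS ho hT (symm_mem_inn.1 h1)
  rw [← h'.1, h.1] at h2
  exact (ht.notMem_vint hS (by simp)).1 h2

/-- Two counterclockwise triangles that are directed in some 3-orientations and share a dart
are equal. -/
theorem IsDirectedTriangle.eq_of_mem {t t' : Finset V} {C C' : Set G.graph.Dart}
    (h : G.IsDirectedTriangle t C) (h' : G.IsDirectedTriangle t' C')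
    (hcc : G.IsCounterclockwise C) (hcc' : G.IsCounterclockwise C')
    {T T' : G.ThreeOrientation} (hT : C ⊆ T.arcs) (hT' : C' ⊆ T'.arcs)
    {d : G.graph.Dart} (hd : d ∈ C) (hd' : d ∈ C') : C = C' := by
  obtain ⟨S, ho, hS⟩ := isCounterclockwise_iff.1 hcc
  obtain ⟨S', ho', hS'⟩ := isCounterclockwise_iff.1 hcc'
  have hconn := h.isConn hS.symm
  have hconn' := h'.isConn hS'.symm
  have hdS : d ∈ G.bd S := hS ▸ hd
  have hdS' : d ∈ G.bd S' := hS' ▸ hd'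
  obtain ⟨d₂, d₃, htri, rfl, rfl⟩ := exists_tri_of_mem h hd
  obtain ⟨e₂, e₃, htri', rfl, rfl⟩ := exists_tri_of_mem h' hd'
  by_cases he : d₃.fst = e₃.fst
  · obtain ⟨rfl, rfl⟩ := htri.eq_of_apex htri' he
    rfl
  -- Rigidity holds for every 3-orientation, so `T` and `T'` may differ. With each apex outside the
  -- other triangle, the two regions contain each other.
  have n1 := not_apex_interior htri htri' hS.symm ho (hT' (by simp))
  have n2 := not_apex_interior htri' htri hS'.symm ho' (hT (by simp))
  have f1 := htri.fst_ne
  have f2 := htri'.fst_ne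
  have m1 : e₃.fst ∈ G.vint Sᶜ := by
    refine (h.vint_or hS.symm ?_).resolve_left n1
    simp only [Finset.mem_insert, Finset.mem_singleton, not_or]
    refine ⟨f2.2.2.symm, ?_, fun h => he h.symm⟩
    rw [← htri.1, htri'.1]; exact f2.2.1.symm
  have m2 : d₃.fst ∈ G.vint S'ᶜ := by
    refine (h'.vint_or hS'.symm ?_).resolve_left n2
    simp only [Finset.mem_insert, Finset.mem_singleton, not_or]
    refine ⟨f1.2.2.symm, ?_, he⟩
    rw [← htri'.1, htri.1]; exact f1.2.1.symm
  have s1 := subset_of_apex_exterior htri' hconn hS'.symm hdS m1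
  have s2 := subset_of_apex_exterior htri hconn' hS.symm hdS' m2
  rw [hS, hS', s1.antisymm s2]

end Triangles

end PlaneTriangulation

namespace PlaneTriangulation

/-! ### From directed dual cuts to directed triangles -/

section DirectedCuts

open scoped Classical

variable {V : Type u} [Fintype V] [DecidableEq V] {G : PlaneTriangulation V}

/-! ### Paths to the outer vertices -/

theorem isOuterVertex_adj {v w : V} (hv : G.IsOuterVertex v) (hw : G.IsOuterVertex w)
    (h : v ≠ w) : G.graph.Adj v w := by
  obtain ⟨d, hd, rfl⟩ := hv
  obtain ⟨d', hd', rfl⟩ := hw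
  rcases left_eq_left_iff.1 (hd'.trans hd.symm) with rfl | rfl | rfl
  · exact absurd rfl h
  · rw [facePerm_fst]; exact d.adj
  · have := (G.emb.facePerm (G.emb.facePerm d)).adj
    rw [facePerm_facePerm_snd] at this
    exact this.symm

theorem exists_isOuterVertex_ne (u : V) : ∃ v, G.IsOuterVertex v ∧ v ≠ u := by
  obtain ⟨d, hd⟩ := exists_dart (G := G)
  by_cases h : d.fst = u
  · refine ⟨d.snd, ⟨G.emb.facePerm d, (left_facePerm d).trans hd, facePerm_fst d⟩, ?_⟩
    rw [← h]; exact d.fst_ne_snd.symm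
  · exact ⟨d.fst, ⟨d, hd, rfl⟩, h⟩

theorem left_mem_of_fst {A : Set G.emb.Face} {v : V}
    (h' : ∀ d : G.graph.Dart, d.fst = v → G.right d ∈ A → G.left d ∈ A)
    {d d' : G.graph.Dart} (hd : d.fst = v) (hd' : d'.fst = v) (hl : G.left d ∈ A) :
    G.left d' ∈ A := by
  refine forall_of_rot (P := fun e => G.left e ∈ A) (hd.trans hd'.symm) (fun e he h1 => ?_) hl
  refine h' _ ((G.emb.rot_fst e).trans (he.trans hd)) ?_
  rwa [right_rot]

/-- The faces around the vertices of a connected set are connected through the edges that touch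
this set, and Euler's inequality bounds the number of these edges. -/
theorem euler_touching {U : Set V} {o : V} {step : V → V → Prop}
    (hstep : ∀ x y, step x y → G.graph.Adj x y) (hU : U = {x | Relation.ReflTransGen step o x})
    (hne : ∃ v, v ∉ U) :
    2 * {f : G.emb.Face | ∃ d, G.left d = f ∧ d.fst ∈ U}.ncard + 2 * U.ncard ≤
      {d : G.graph.Dart | d.fst ∈ U ∨ d.snd ∈ U}.ncard + 2 := by
  set S : Set G.emb.Face := {f : G.emb.Face | ∃ d, G.left d = f ∧ d.fst ∈ U} with hS
  set D : Set G.graph.Dart := {d : G.graph.Dart | d.fst ∈ U ∨ d.snd ∈ U} with hD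
  have := euler_inequality (G := G) (D := D.toFinset) (W := U.toFinset)
    (S := S.toFinset) ?_ ?_ ?_ ?_ ?_
  · simpa only [← Set.ncard_eq_toFinset_card'] using this
  · intro d
    simp only [Set.mem_toFinset, hD, Set.mem_ofPred_eq]
    exact fun h => h.symm
  · intro d
    simp only [Set.mem_toFinset, hD, Set.mem_ofPred_eq]
    exact Or.inl
  · simpa using hne
  · intro d
    simp only [Set.mem_toFinset, hD, Set.mem_ofPred_eq, hS]
    rintro (h | h)
    · exact ⟨d, rfl, h⟩
    · exact ⟨G.emb.facePerm d, left_facePerm d, by rwa [facePerm_fst]⟩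
  · intro A hA ⟨f, hf⟩ hcl
    have h1 : ∀ d : G.graph.Dart, (d.fst ∈ U ∨ d.snd ∈ U) → (G.left d ∈ A ↔ G.right d ∈ A) := by
      intro d hd
      refine ⟨hcl d (by simpa [hD] using hd), fun h => ?_⟩
      have := hcl d.symm (by simpa [hD] using hd.symm) h
      rwa [right_symm] at this
    have h2 : ∀ d d' : G.graph.Dart, d.fst ∈ U → d'.fst = d.fst →
        (G.left d ∈ A ↔ G.left d' ∈ A) := by
      intro d d' hd hdd
      have a2 : ∀ e : G.graph.Dart, e.fst = d.fst → G.right e ∈ (A : Set G.emb.Face) →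
          G.left e ∈ (A : Set G.emb.Face) := fun e he => (h1 e (Or.inl (he ▸ hd))).2
      exact ⟨left_mem_of_fst (v := d.fst) a2 rfl hdd, left_mem_of_fst (v := d.fst) a2 hdd rfl⟩
    have h3 : ∀ x, Relation.ReflTransGen step o x → ∀ d d' : G.graph.Dart, d.fst = o →
        d'.fst = x → (G.left d ∈ A ↔ G.left d' ∈ A) := by
      intro x hx
      have ho : o ∈ U := by rw [hU]; exact Relation.ReflTransGen.refl
      induction hx with
      | refl =>
        intro d d' hd hd'
        exact h2 d d' (hd ▸ ho) (hd'.trans hd.symm)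
      | @tail y z hy hyz ih =>
        intro d d' hd hd'
        have hyU : y ∈ U := by rw [hU]; exact hy
        have hzU : z ∈ U := by rw [hU]; exact hy.tail hyz
        let e : G.graph.Dart := ⟨(y, z), hstep _ _ hyz⟩
        rw [ih d e hd rfl, h1 e (Or.inl hyU)]
        exact h2 e.symm d' hzU hd'
    obtain ⟨e, he⟩ := exists_dart_fst (G := G) o
    have h4 : ∀ d : G.graph.Dart, d.fst ∈ U → (G.left e ∈ A ↔ G.left d ∈ A) := by
      intro d hd
      rw [hU] at hd
      exact h3 _ hd e d he rfl
    refine hA.antisymm (fun g hg => ?_)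
    obtain ⟨d, rfl, hd⟩ : g ∈ S := by simpa using hg
    obtain ⟨d', rfl, hd'⟩ : f ∈ S := by simpa using hA hf
    rwa [← h4 d hd, h4 d' hd']

namespace ThreeOrientation

theorem not_isOuterDart (T : G.ThreeOrientation) {d : G.graph.Dart} (h : d ∈ T.arcs) :
    ¬ G.IsOuterDart d := fun h' => T.outer_edge d h' h

theorem symm_notMem (T : G.ThreeOrientation) {d : G.graph.Dart} (h : d ∈ T.arcs) :
    d.symm ∉ T.arcs := (T.inner_edge d (T.not_isOuterDart h)).1 h

/-- The arcs that leave a set of inner vertices do not all end in one vertex. -/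
theorem exists_arc_leaving (T : G.ThreeOrientation) {Y : Set V} (hne : Y.Nonempty)
    (hY : ∀ v ∈ Y, ¬ G.IsOuterVertex v) {u : V} (hu : u ∉ Y) :
    ∃ d ∈ T.arcs, d.fst ∈ Y ∧ d.snd ∉ Y ∧ d.snd ≠ u := by
  by_contra hc
  push Not at hc
  obtain ⟨o, ho, hou⟩ := exists_isOuterVertex_ne (G := G) u
  set step : V → V → Prop := fun x y => G.graph.Adj x y ∧ y ∉ Y ∧ y ≠ u with hstep
  -- The component of an outer vertex after deleting `Y` and `u`. Under the contrary assumption, no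
  -- arc from the remaining vertices `Y'` ends in `U`.
  set U : Set V := {x | Relation.ReflTransGen step o x} with hU
  have hoU : o ∈ U := Relation.ReflTransGen.refl
  have hUY : ∀ x ∈ U, x ∉ Y ∧ x ≠ u := by
    intro x hx
    rcases Relation.ReflTransGen.cases_tail hx with rfl | ⟨y, _, h⟩
    · exact ⟨fun h => hY _ h ho, hou⟩
    · exact h.2
  have hUadj : ∀ x ∈ U, ∀ y, G.graph.Adj x y → y ∉ Y → y ≠ u → y ∈ U :=
    fun x hx y h1 h2 h3 => Relation.ReflTransGen.tail hx ⟨h1, h2, h3⟩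
  have hE := euler_touching (G := G) (fun x y (h : step x y) => h.1) hU
    ⟨u, fun h => (hUY u h).2 rfl⟩
  set S : Set G.emb.Face := {f : G.emb.Face | ∃ d, G.left d = f ∧ d.fst ∈ U} with hS
  set D : Set G.graph.Dart := {d : G.graph.Dart | d.fst ∈ U ∨ d.snd ∈ U} with hD
  set Y' : Set V := {v | v ∉ U ∧ v ≠ u} with hY'
  have hY'in : ∀ v ∈ Y', ¬ G.IsOuterVertex v := by
    rintro v ⟨h1, h2⟩ h3
    by_cases h4 : o = v
    · exact h1 (h4 ▸ hoU)
    · exact h1 (hUadj o hoU v (isOuterVertex_adj ho h3 h4) (fun h => hY v h h3) h2)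
  have hY'arc : ∀ d ∈ T.arcs, d.fst ∈ Y' → d.snd ∉ U := by
    rintro d hd ⟨h1, h2⟩ h3
    by_cases h4 : d.fst ∈ Y
    · by_cases h5 : d.snd ∈ Y
      · exact (hUY _ h3).1 h5
      · exact (hUY _ h3).2 (hc d hd h4 h5)
    · exact h1 (hUadj _ h3 _ d.adj.symm h4 h2)
  have hcardV : U.ncard + Y'.ncard + 1 = Fintype.card V := by
    rw [← Set.ncard_union_eq, ← Set.ncard_singleton u, ← Set.ncard_union_eq,
      ← Nat.card_eq_fintype_card, ← Set.ncard_univ]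
    · congr 1
      ext v
      simp only [hY', Set.mem_union, Set.mem_ofPred_eq, Set.mem_singleton_iff, Set.mem_univ,
        iff_true]
      tauto
    · rw [Set.disjoint_left]
      rintro v (h1 | h1) rfl
      · exact (hUY _ h1).2 rfl
      · exact h1.2 rfl
    · rw [Set.disjoint_left]
      exact fun v h1 h2 => h2.1 h1
  set B : Set G.graph.Dart := {d ∈ T.arcs | d.fst ∈ Y'} with hB
  have hBcard : B.ncard = 3 * Y'.ncard := T.card_arcs_fst_mem hY'in
  have hBrev : (rev B).ncard = B.ncard :=
    Set.ncard_congr (fun d _ => d.symm) (fun d hd => hd)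
      (fun d d' _ _ h => by simpa using congrArg SimpleGraph.Dart.symm h)
      (fun d hd => ⟨d.symm, by simpa [mem_rev] using hd, by simp⟩)
  have hBD : ∀ d ∈ B, d ∉ D := by
    rintro d ⟨h1, h2⟩ (h3 | h3)
    · exact h2.1 h3
    · exact hY'arc d h1 h2 h3
  have hcardD : D.ncard + (B.ncard + (rev B).ncard) ≤ Fintype.card G.graph.Dart := by
    rw [← Set.ncard_union_eq, ← Set.ncard_union_eq, ← Nat.card_eq_fintype_card, ← Set.ncard_univ]
    · exact Set.ncard_le_ncard (Set.subset_univ _)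
    · rw [Set.disjoint_left]
      rintro d h1 (h2 | h2)
      · exact hBD d h2 h1
      · exact hBD _ h2 h1.symm
    · rw [Set.disjoint_left]
      rintro d h1 h2
      exact T.symm_notMem h1.1 h2.1
  have hDS : ∀ d ∈ D, G.left d ∈ S := by
    rintro d (h | h)
    · exact ⟨d, rfl, h⟩
    · exact ⟨G.emb.facePerm d, left_facePerm d, by rwa [facePerm_fst]⟩
  have hcardS : D.ncard + {d : G.graph.Dart | G.left d ∈ S ∧ d ∉ D}.ncard = 3 * S.ncard := by
    have h := card_filter_left_mem (G := G) S.toFinset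
    rw [← Set.ncard_eq_toFinset_card'] at h
    rw [← h, ← Set.ncard_union_eq, ← Set.ncard_coe_finset]
    · congr 1
      ext d
      simp only [Set.mem_union, Set.mem_ofPred_eq, Finset.coe_filter, Set.mem_toFinset,
        Finset.mem_univ, true_and]
      have := hDS d
      tauto
    · rw [Set.disjoint_left]
      exact fun d h1 h2 => h2.2 h1
  have e1 := card_face (G := G)
  have e2 := card_dart (G := G)
  -- The `3 * Y'.ncard` edges avoiding `U` give `D.ncard ≤ 6 * U.ncard - 6`, which Euler's
  -- inequality permits only if every side of every face touching `U` touches `U`. Then by dual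
  -- connectivity all edges touch `U`, a contradiction.
  have hm : {d : G.graph.Dart | G.left d ∈ S ∧ d ∉ D}.ncard = 0 := by omega
  rw [Set.ncard_eq_zero] at hm
  have hSD : ∀ d, G.left d ∈ S → d ∈ D := by
    intro d hd
    by_contra h
    exact Set.notMem_empty d (hm ▸ (show d ∈ {d : G.graph.Dart | G.left d ∈ S ∧ d ∉ D} from ⟨hd, h⟩))
  obtain ⟨e, he⟩ := exists_dart_fst (G := G) o
  have hSall := face_connected (A := S) ⟨_, e, rfl, he ▸ hoU⟩
    (fun d hd => hDS d.symm ((hSD d hd).symm))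
  have hY'ne : Y'.Nonempty := by
    obtain ⟨y, hy⟩ := hne
    exact ⟨y, fun h => (hUY y h).1 hy, fun h => hu (h ▸ hy)⟩
  have hBne : B.Nonempty := by
    rw [← Set.ncard_pos, hBcard]
    have := (Set.ncard_pos (s := Y')).2 hY'ne
    omega
  obtain ⟨d, hd⟩ := hBne
  exact hBD d hd (hSD d (hSall _))

end ThreeOrientation

/-! ### Flows along paths -/

/-- Counts how often a walk uses each dart; repetitions do no harm, so no simple path has to be
extracted. -/
theorem exists_flow {A : Set G.graph.Dart} {u w : V}
    (h : Relation.ReflTransGen (fun x y => ∃ d ∈ A, d.fst = x ∧ d.snd = y) u w) :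
    ∃ x : G.graph.Dart → ℤ, (∀ d, 0 ≤ x d) ∧ (∀ d, x d ≠ 0 → d ∈ A) ∧
      ∀ v, div x v = (if u = v then 1 else 0) - (if w = v then 1 else 0) := by
  induction h with
  | refl => exact ⟨fun _ => 0, by simp, by simp, fun v => by simp [div_eq]⟩
  | @tail y z _ hyz ih =>
    obtain ⟨x, h1, h2, h3⟩ := ih
    obtain ⟨e, heA, rfl, rfl⟩ := hyz
    refine ⟨fun d => x d + if d = e then 1 else 0, fun d => ?_, fun d hd => ?_, fun v => ?_⟩
    · have := h1 d
      change 0 ≤ x d + if d = e then 1 else 0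
      split_ifs <;> omega
    · by_cases hde : d = e
      · exact hde ▸ heA
      · refine h2 d ?_
        simpa [hde] using hd
    · rw [div_add, h3, div_eq (fun d => if d = e then 1 else 0)]
      simp

/-! ### Filled sets of faces -/

/-- The faces that are not separated by `X` from the outer face. -/
def outerPart (G : PlaneTriangulation V) (X : Set G.emb.Face) : Set G.emb.Face :=
  {f | Relation.ReflTransGen (fun f g => ∃ d, G.left d = f ∧ G.right d = g ∧ g ∉ X) G.outer f}

theorem outer_mem_outerPart (X : Set G.emb.Face) : G.outer ∈ G.outerPart X :=
  Relation.ReflTransGen.refl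

theorem right_mem_outerPart {X : Set G.emb.Face} {d : G.graph.Dart}
    (h : G.left d ∈ G.outerPart X) (h' : G.right d ∉ X) : G.right d ∈ G.outerPart X :=
  Relation.ReflTransGen.tail h ⟨d, rfl, rfl, h'⟩

theorem left_mem_outerPart {X : Set G.emb.Face} {d : G.graph.Dart}
    (h : G.right d ∈ G.outerPart X) (h' : G.left d ∉ X) : G.left d ∈ G.outerPart X := by
  have := right_mem_outerPart (d := d.symm) h
  rw [right_symm] at this
  exact this h'

theorem outerPart_disjoint {X : Set G.emb.Face} (ho : G.outer ∉ X) {f : G.emb.Face}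
    (hf : f ∈ G.outerPart X) : f ∉ X := by
  rcases Relation.ReflTransGen.cases_tail hf with rfl | ⟨g, _, d, _, _, h⟩
  · exact ho
  · exact h

/-- Filling the holes of `X` creates no boundary darts, so a directed cut stays directed. -/
theorem bd_compl_outerPart {X : Set G.emb.Face} (ho : G.outer ∉ X) :
    G.bd (G.outerPart X)ᶜ ⊆ G.bd X := by
  rintro d ⟨h1, h2⟩
  rw [Set.mem_compl_iff, not_not] at h2
  refine ⟨?_, outerPart_disjoint ho h2⟩
  by_contra h3
  exact h1 (left_mem_outerPart h2 h3)

theorem isConn_outerPart (X : Set G.emb.Face) : G.IsConn (G.outerPart X) := by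
  intro A hA ⟨f, hf⟩ hcl
  have hiff : ∀ g, g ∈ G.outerPart X → (G.outer ∈ A ↔ g ∈ A) := by
    intro g hg
    induction hg with
    | refl => rfl
    | @tail g k hg hgk ih =>
      have hk : k ∈ G.outerPart X := Relation.ReflTransGen.tail hg hgk
      obtain ⟨d, rfl, rfl, h⟩ := hgk
      rw [ih]
      refine ⟨fun h1 => hcl d h1 hk, fun h1 => ?_⟩
      have := hcl d.symm h1 (by rw [right_symm]; exact hg)
      rwa [right_symm] at this
  refine hA.antisymm (fun g hg => ?_)
  rw [← hiff g hg, hiff f (hA hf)]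
  exact hf

theorem compl_subset_outerPart {X S : Set G.emb.Face} (hXS : X ⊆ S) (ho : G.outer ∉ S)
    (hS : G.IsConn Sᶜ) : Sᶜ ⊆ G.outerPart X := by
  have := hS (G.outerPart X ∩ Sᶜ) Set.inter_subset_right
    ⟨G.outer, outer_mem_outerPart X, ho⟩
    (fun d h1 h2 => ⟨right_mem_outerPart h1.1 (fun h => h2 (hXS h)), h2⟩)
  exact Set.inter_eq_right.1 this

theorem IsConn.const {S : Set G.emb.Face} (hS : G.IsConn S) {q : G.emb.Face → ℤ}
    (hq : ∀ d ∈ G.inn S, q (G.left d) = q (G.right d)) {f g : G.emb.Face} (hf : f ∈ S)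
    (hg : g ∈ S) : q f = q g := by
  have := hS {k | k ∈ S ∧ q k = q g} (fun k hk => hk.1) ⟨g, hg, rfl⟩ (by
    rintro d ⟨h1, h2⟩ h3
    exact ⟨h3, by rw [← hq d ⟨h1, h3⟩, h2]⟩)
  have hf' : f ∈ {k | k ∈ S ∧ q k = q g} := by rw [this]; exact hf
  exact hf'.2

theorem div_bd (S : Set G.emb.Face) (v : V) :
    div (fun d => if d ∈ G.bd S then (1 : ℤ) else 0) v = 0 := by
  refine Eq.trans ?_ (div_face (ind S) v)
  refine Finset.sum_congr rfl (fun d _ => ?_)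
  rw [ind_sub]

/-- The boundary is a circulation, so what enters a vertex must leave it. -/
theorem exists_next {S : Set G.emb.Face} {d : G.graph.Dart} (hd : d ∈ G.bd S) :
    ∃ e ∈ G.bd S, e.fst = d.snd := by
  by_contra hc
  push Not at hc
  have h := div_bd S d.snd
  rw [div_eq] at h
  have h1 := Finset.sum_lt_sum (s := Finset.univ) (f := fun e : G.graph.Dart =>
    (if e ∈ G.bd S then (1 : ℤ) else 0) *
      ((if e.fst = d.snd then 1 else 0) - (if e.snd = d.snd then 1 else 0)))
    (g := fun _ => 0) (fun e _ => by
      by_cases he : e ∈ G.bd S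
      · rw [if_neg (hc e he)]; simp only [he]; split_ifs <;> simp
      · simp [he])
    ⟨d, Finset.mem_univ _, by simp [hd, d.fst_ne_snd]⟩
  rw [h] at h1
  simp at h1

/-- If `S` and its complement are connected, then the boundary of `S` is strongly connected. -/
theorem bd_reachable {S : Set G.emb.Face} (hS : G.IsConn S) (hS' : G.IsConn Sᶜ) {e e' : G.graph.Dart}
    (he : e ∈ G.bd S) (he' : e' ∈ G.bd S) {u w : V} (hw : e.fst = w ∨ e.snd = w)
    (hu : e'.fst = u ∨ e'.snd = u) :
    Relation.ReflTransGen (fun x y => ∃ d ∈ G.bd S, d.fst = x ∧ d.snd = y) w u := by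
  set X : Set V := {v | Relation.ReflTransGen
    (fun x y => ∃ d ∈ G.bd S, d.fst = x ∧ d.snd = y) w v} with hX
  have hfs : ∀ d ∈ G.bd S, d.fst ∈ X → d.snd ∈ X := fun d hd h =>
    Relation.ReflTransGen.tail h ⟨d, hd, rfl, rfl⟩
  -- No boundary dart leaves `X`, and the net flow out of `X` is zero, so none enters it.
  have hsf : ∀ d ∈ G.bd S, d.snd ∈ X → d.fst ∈ X := by
    intro d hd hdX
    by_contra hc
    have h0 : ∑ v ∈ X.toFinset, div (fun d => if d ∈ G.bd S then (1 : ℤ) else 0) v = 0 :=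
      Finset.sum_eq_zero (fun v _ => div_bd S v)
    simp only [div_eq] at h0
    rw [Finset.sum_comm] at h0
    have h1 : ∀ e : G.graph.Dart, ∑ v ∈ X.toFinset, (if e ∈ G.bd S then (1 : ℤ) else 0) *
        ((if e.fst = v then 1 else 0) - (if e.snd = v then 1 else 0)) =
        (if e ∈ G.bd S then (1 : ℤ) else 0) *
        ((if e.fst ∈ X then 1 else 0) - (if e.snd ∈ X then 1 else 0)) := by
      intro e
      rw [← Finset.mul_sum, Finset.sum_sub_distrib]
      simp
    simp only [h1] at h0
    have h2 := Finset.sum_lt_sum (s := Finset.univ) (f := fun e : G.graph.Dart =>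
      (if e ∈ G.bd S then (1 : ℤ) else 0) *
        ((if e.fst ∈ X then 1 else 0) - (if e.snd ∈ X then 1 else 0)))
      (g := fun _ => 0) (fun e _ => by
        by_cases he : e ∈ G.bd S
        · have := hfs e he
          by_cases h3 : e.fst ∈ X
          · simp [h3, this h3]
          · by_cases h4 : e.snd ∈ X <;> simp [he, h3, h4]
        · simp [he])
      ⟨d, Finset.mem_univ _, by simp [hd, hc, hdX]⟩
    rw [h0] at h2
    simp at h2
  -- The part of the boundary reachable from `w` is itself a circulation. Its potential is constant
  -- on `S` and on the complement, so this part is all of the boundary or nothing.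
  set x : G.graph.Dart → ℤ := fun d => if d ∈ G.bd S ∧ d.fst ∈ X then 1 else 0 with hx
  have hdiv : ∀ v, div x v = 0 := by
    intro v
    by_cases hv : v ∈ X
    · rw [← div_bd S v, div_eq, div_eq]
      refine Finset.sum_congr rfl (fun d _ => ?_)
      by_cases hd : d ∈ G.bd S
      · by_cases hdX : d.fst ∈ X
        · simp [hx, hd, hdX]
        · have h1 : d.fst ≠ v := fun h => hdX (h ▸ hv)
          have h2 : d.snd ≠ v := fun h => hdX (hsf d hd (h ▸ hv))
          simp [h1, h2]
      · simp [hx, hd]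
    · rw [div_eq]
      refine Finset.sum_eq_zero (fun d _ => ?_)
      by_cases hd : d ∈ G.bd S ∧ d.fst ∈ X
      · have h1 : d.fst ≠ v := fun h => hv (h ▸ hd.2)
        have h2 : d.snd ≠ v := fun h => hv (h ▸ hfs d hd.1 hd.2)
        simp [h1, h2]
      · simp [hx, hd]
  obtain ⟨q, -, hq⟩ := exists_potential x hdiv
  have hz : ∀ d, d ∉ G.bd S → d.symm ∉ G.bd S → q (G.left d) = q (G.right d) := by
    intro d h1 h2
    have := hq d
    simp only [hx, h1, h2, false_and, if_false] at this
    linarith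
  have hin := fun (d : G.graph.Dart) (hd : d ∈ G.inn S) =>
    hz d (fun h => h.2 hd.2) (fun h => h.2 (by rw [right_symm]; exact hd.1))
  have hout := fun (d : G.graph.Dart) (hd : d ∈ G.inn Sᶜ) =>
    hz d (fun h => hd.1 h.1) (fun h => hd.2 h.1)
  have hsymm : ∀ d ∈ G.bd S, d.symm ∉ G.bd S := fun d hd h => hd.2 h.1
  have hxval : ∀ d ∈ G.bd S, x d = q (G.left d) - q (G.right d) := by
    intro d hd
    rw [← hq d]
    simp [hx, hsymm d hd]
  have hxe : x e = x e' := by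
    rw [hxval e he, hxval e' he', hS.const hin he.1 he'.1, hS'.const hout he.2 he'.2]
  have hwX : w ∈ X := Relation.ReflTransGen.refl
  have heX : e.fst ∈ X := by
    rcases hw with h | h
    · rw [h]; exact hwX
    · exact hsf e he (h ▸ hwX)
  have he'X : e'.fst ∈ X := by
    by_contra hc
    simp [hx, he, heX, hc] at hxe
  rcases hu with h | h
  · rw [← h]; exact he'X
  · rw [← h]; exact hfs e' he' he'X

theorem exists_bd_of_inn {S : Set G.emb.Face} {d : G.graph.Dart} (hd : d ∈ G.inn S)
    (hv : d.fst ∉ G.vint S) : ∃ e ∈ G.bd S, e.fst = d.fst ∨ e.snd = d.fst := by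
  by_contra hc
  push Not at hc
  rcases vint_or (G := G) (S := S) (v := d.fst)
    (fun e he => ⟨fun h => (hc e h).1 he, fun h => (hc e.symm h).2 he⟩) with h | h
  · exact hv h
  · exact h d rfl hd.1

namespace ThreeOrientation

variable (T : G.ThreeOrientation)

/-- In a minimal closed filled set of faces all arcs point from the interior vertices. -/
theorem fst_mem_vint_of_minimal {S : Set G.emb.Face} (ho : G.outer ∉ S) (hT : G.bd S ⊆ T.arcs)
    (hS : G.IsConn S) (hS' : G.IsConn Sᶜ)
    (hmin : ∀ X ⊆ S, X.Nonempty → G.bd X ⊆ T.arcs → ∀ d ∈ G.bd S, G.left d ∈ X)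
    {d₀ : G.graph.Dart} (h₀ : d₀ ∈ T.arcs) (h₀S : d₀ ∈ G.inn S) : d₀.fst ∈ G.vint S := by
  by_contra hu
  set u := d₀.fst with hudef
  -- An arc entering the interior from `u` extends to a directed path inside `S` that reaches the
  -- boundary at a vertex other than `u`; otherwise the interior vertices reached would have all
  -- leaving arcs end in `u`.
  have hw : ∃ w, Relation.ReflTransGen (fun x y => ∃ d ∈ T.arcs ∩ G.inn S, d.fst = x ∧ d.snd = y)
      d₀.snd w ∧ w ∉ G.vint S ∧ w ≠ u := by
    by_contra hc
    push Not at hc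
    set Y : Set V := {w | Relation.ReflTransGen
      (fun x y => ∃ d ∈ T.arcs ∩ G.inn S, d.fst = x ∧ d.snd = y) d₀.snd w ∧ w ∈ G.vint S} with hY
    have hne : Y.Nonempty := by
      refine ⟨d₀.snd, Relation.ReflTransGen.refl, ?_⟩
      by_contra h
      exact d₀.fst_ne_snd (hc _ Relation.ReflTransGen.refl h).symm
    obtain ⟨d, hd, h1, h2, h3⟩ := T.exists_arc_leaving hne
      (fun v hv => not_isOuterVertex_of_vint ho hv.2) (u := u) (fun h => hu h.2)
    have h4 : Relation.ReflTransGen (fun x y => ∃ d ∈ T.arcs ∩ G.inn S, d.fst = x ∧ d.snd = y)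
        d₀.snd d.snd := h1.1.tail ⟨d, ⟨hd, mem_inn_of_vint h1.2⟩, rfl, rfl⟩
    by_cases h5 : d.snd ∈ G.vint S
    · exact h2 ⟨h4, h5⟩
    · exact h3 (hc _ h4 h5)
  obtain ⟨w, hrw, hwv, hwu⟩ := hw
  have hpath : Relation.ReflTransGen (fun x y => ∃ d ∈ T.arcs ∩ G.inn S, d.fst = x ∧ d.snd = y)
      u w := Relation.ReflTransGen.head ⟨d₀, ⟨h₀, h₀S⟩, rfl, rfl⟩ hrw
  obtain ⟨e', he', hue⟩ := exists_bd_of_inn h₀S hu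
  obtain ⟨e, he, hwe⟩ : ∃ e ∈ G.bd S, e.fst = w ∨ e.snd = w := by
    rcases Relation.ReflTransGen.cases_tail hpath with h | ⟨y, _, d, hd, _, rfl⟩
    · exact absurd h hwu
    · exact exists_bd_of_inn (d := d.symm) (symm_mem_inn.2 hd.2) hwv
  obtain ⟨x, hx0, hxs, hxd⟩ := exists_flow hpath
  obtain ⟨y, hy0, hys, hyd⟩ := exists_flow (bd_reachable hS hS' he he' hwe hue)
  -- Closing the path along the boundary of `S` gives a circulation of arcs. Each superlevel set of
  -- its potential at a positive level is a directed cut inside `S`.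
  obtain ⟨q, hq0, hq⟩ := exists_potential (fun d => x d + y d) (fun v => by
    rw [div_add, hxd, hyd]; ring)
  have hxz : ∀ d, d ∉ G.inn S → x d = 0 := fun d hd => by
    by_contra h; exact hd (hxs d h).2
  have hyz : ∀ d, d ∉ G.bd S → y d = 0 := fun d hd => by
    by_contra h; exact hd (hys d h)
  have hqout : ∀ f ∉ S, q f = 0 := by
    intro f hf
    rw [← hq0]
    refine hS'.const (fun d hd => ?_) hf ho
    have := hq d
    rw [hxz d (fun h => hd.1 h.1), hxz d.symm (fun h => hd.2 h.1), hyz d (fun h => hd.1 h.1),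
      hyz d.symm (fun h => hd.2 h.1)] at this
    linarith
  have hqbd : ∀ d ∈ G.bd S, q (G.left d) = y d := by
    intro d hd
    have := hq d
    rw [hqout _ hd.2, hxz d (fun h => hd.2 h.2), hxz d.symm (fun h => hd.2 h.1),
      hyz d.symm (fun h => hd.2 h.1)] at this
    linarith
  have hlevel : ∀ d ∈ G.bd S, 1 ≤ y d → ∀ d' ∈ G.bd S, y d ≤ y d' := by
    intro d hd hpos d' hd'
    rw [← hqbd d' hd']
    refine hmin {f | y d ≤ q f} ?_ ⟨G.left d, (hqbd d hd).ge⟩ ?_ d' hd'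
    · intro f hf
      by_contra h
      have : y d ≤ q f := hf
      rw [hqout f h] at this
      linarith
    · rintro k ⟨h1, h2⟩
      simp only [Set.mem_ofPred_eq, not_le] at h1 h2
      have h3 := hq k
      have h4 : 0 < x k + y k := by
        have := hx0 k.symm
        have := hy0 k.symm
        linarith
      by_contra h5
      have h6 : x k = 0 := by by_contra h; exact h5 (hxs k h).1
      have h7 : y k = 0 := by by_contra h; exact h5 (hT (hys k h))
      omega
  -- By minimality every such level set touches the whole boundary, so `y` is a multiple of the
  -- boundary circulation. This contradicts the net outflow `1` of `y` at `w`.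
  have hconst : ∀ d ∈ G.bd S, y d = y e := by
    intro d hd
    by_cases h1 : 1 ≤ y e
    · have h2 := hlevel e he h1 d hd
      exact le_antisymm (hlevel d hd (h1.trans h2) e he) h2
    · by_cases h2 : 1 ≤ y d
      · exact absurd (h2.trans (hlevel d hd h2 e he)) h1
      · have := hy0 d
        have := hy0 e
        omega
  have hdy : div y w = y e * div (fun d => if d ∈ G.bd S then (1 : ℤ) else 0) w := by
    rw [div_eq, div_eq, Finset.mul_sum]
    refine Finset.sum_congr rfl (fun d _ => ?_)
    by_cases hd : d ∈ G.bd S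
    · simp [hd, hconst d hd]
    · simp [hd, hyz d hd]
  rw [div_bd, hyd, if_pos rfl, if_neg hwu.symm] at hdy
  norm_num at hdy

/-- Successive boundary darts never backtrack, so three of them are distinct and exhaust the
boundary; the fourth must be the first again. -/
theorem exists_isDirectedTriangle_of_card {S : Set G.emb.Face} (hne : (G.bd S).Nonempty)
    (hcard : (G.bd S).ncard ≤ 3) : ∃ t, G.IsDirectedTriangle t (G.bd S) := by
  have hs : ∀ d ∈ G.bd S, ∀ d' ∈ G.bd S, d.fst = d'.snd → d'.fst ≠ d.snd := by
    intro d hd d' hd' h1 h2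
    have : d' = d.symm := dart_eq h2 h1.symm
    rw [this] at hd'
    exact hd.2 hd'.1
  obtain ⟨d₁, h₁⟩ := hne
  obtain ⟨d₂, h₂, e₂⟩ := exists_next h₁
  obtain ⟨d₃, h₃, e₃⟩ := exists_next h₂
  obtain ⟨d₄, h₄, e₄⟩ := exists_next h₃
  have n12 : d₁ ≠ d₂ := by rintro rfl; exact d₁.fst_ne_snd e₂
  have n23 : d₂ ≠ d₃ := by rintro rfl; exact d₂.fst_ne_snd e₃
  have n13 : d₁ ≠ d₃ := by rintro rfl; exact hs _ h₂ _ h₁ e₂ e₃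
  have heq : ({d₁, d₂, d₃} : Set G.graph.Dart) = G.bd S := by
    refine Set.eq_of_subset_of_ncard_le ?_ ?_
    · rintro d (rfl | rfl | rfl) <;> assumption
    · rw [Set.ncard_eq_three.2 ⟨_, _, _, n12, n13, n23, rfl⟩]; exact hcard
  have h41 : d₄ = d₁ := by
    rw [← heq] at h₄
    rcases h₄ with rfl | rfl | rfl
    · rfl
    · exact absurd e₄ (fun h => hs _ h₃ _ h₂ e₃ h)
    · exact absurd e₄ d₄.fst_ne_snd
  rw [h41] at e₄
  exact ⟨_, isDirectedTriangle_iff.2 ⟨d₁, d₂, d₃, ⟨e₂.symm, e₃.symm, e₄.symm⟩, heq.symm, rfl⟩⟩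

/-- If a 3-orientation has a counterclockwise directed cut in the dual graph, then it has a
counterclockwise directed triangle. -/
theorem exists_ccw_triangle {S₀ : Set G.emb.Face} (hne : S₀.Nonempty) (ho : G.outer ∉ S₀)
    (hT : G.bd S₀ ⊆ T.arcs) :
    ∃ t C, G.IsDirectedTriangle t C ∧ G.IsCounterclockwise C ∧ C ⊆ T.arcs := by
  set P : Set G.emb.Face → Prop := fun S => S.Nonempty ∧ G.outer ∉ S ∧ G.bd S ⊆ T.arcs ∧
    G.IsConn Sᶜ with hP
  have hfill : ∀ X : Set G.emb.Face, X.Nonempty → G.outer ∉ X → G.bd X ⊆ T.arcs →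
      P (G.outerPart X)ᶜ := by
    intro X ⟨f, hf⟩ h1 h2
    refine ⟨⟨f, fun h => outerPart_disjoint h1 h hf⟩, fun h => h (outer_mem_outerPart X),
      (bd_compl_outerPart h1).trans h2, ?_⟩
    rw [compl_compl]
    exact isConn_outerPart X
  obtain ⟨S, hS, hmin⟩ := (measure (fun S : Set G.emb.Face => S.ncard)).wf.has_min
    {S | P S} ⟨_, hfill S₀ hne ho hT⟩
  obtain ⟨hSne, hSo, hST, hSc⟩ := hS
  have hmin' : ∀ X ⊆ S, X.Nonempty → G.bd X ⊆ T.arcs → ∀ d ∈ G.bd S, G.left d ∈ X := by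
    intro X hX hXne hXT d hd
    have h1 := compl_subset_outerPart hX hSo hSc
    have h2 : (G.outerPart X)ᶜ = S := by
      refine Set.eq_of_subset_of_ncard_le (Set.compl_subset_comm.1 h1) ?_
      exact not_lt.1 (hmin _ (hfill X hXne (fun h => hSo (hX h)) hXT))
    by_contra h3
    have h4 := left_mem_outerPart (h1 hd.2) h3
    have h5 := hd.1
    rw [← h2] at h5
    exact h5 h4
  have hbdne : (G.bd S).Nonempty := bd_nonempty hSne ⟨_, hSo⟩
  -- If `S` split, both pieces would have directed boundary, and by minimality both would contain
  -- the left face of the same boundary dart.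
  have hSconn : G.IsConn S := by
    intro A hA hAne hcl
    by_contra hAS
    obtain ⟨d, hd⟩ := hbdne
    have h1 := hmin' A hA hAne (fun d hd => hST ⟨hA hd.1, fun h => hd.2 (hcl d hd.1 h)⟩) d hd
    have h2 := hmin' (S \ A) Set.sdiff_subset
      (Set.nonempty_of_ssubset (hA.ssubset_of_ne hAS)) (by
        rintro e ⟨⟨h3, h4⟩, h5⟩
        refine hST ⟨h3, fun h6 => ?_⟩
        have h7 : G.right e ∈ A := by by_contra h; exact h5 ⟨h6, h⟩
        have := hcl e.symm h7 (by rw [right_symm]; exact h3)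
        rw [right_symm] at this
        exact h4 this) d hd
    exact h2.2 h1
  have hfst := fun (d : G.graph.Dart) (h : d ∈ T.arcs) (h' : d ∈ G.inn S) =>
    T.fst_mem_vint_of_minimal hSo hST hSconn hSc hmin' h h'
  have c1 := T.card_arcs_of_symm (D := G.inn S) (fun d hd => symm_mem_inn.2 hd)
    (fun d hd => not_isOuterDart_of_inn hSo hd)
  have c2 := T.card_arcs_fst_mem (Y := G.vint S) (fun v hv => not_isOuterVertex_of_vint hSo hv)
  have c3 : {d ∈ T.arcs | d.fst ∈ G.vint S} = T.arcs ∩ G.inn S := by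
    ext d
    exact ⟨fun h => ⟨h.1, mem_inn_of_vint h.2⟩, fun h => ⟨h.1, hfst d h.1 h.2⟩⟩
  rw [c3] at c2
  have c4 := card_inn_add_card_bd S
  have c5 := hSconn.euler ⟨_, hSo⟩
  -- The interior has three edges per inner vertex, so Euler's inequality leaves at most three
  -- boundary darts.
  obtain ⟨t, ht⟩ := exists_isDirectedTriangle_of_card hbdne (by omega)
  exact ⟨t, _, ht, isCounterclockwise_iff.2 ⟨S, hSo, rfl⟩, hST⟩

end ThreeOrientation

end DirectedCuts

end PlaneTriangulation

/-! ### Labelled transition systems with the diamond property -/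

section Diamond

variable {α L : Type*}

/-- `l` is the list of the labels along a path of transitions. -/
def IsStepPath (step : α → L → α → Prop) : α → List L → α → Prop
  | a, [], b => a = b
  | a, t :: l, b => ∃ c, step a t c ∧ IsStepPath step c l b

theorem IsStepPath.append {step : α → L → α → Prop} {l l' : List L} {a b c : α}
    (h : IsStepPath step a l b) (h' : IsStepPath step b l' c) : IsStepPath step a (l ++ l') c := by
  induction l generalizing a with
  | nil => cases h; exact h'
  | cons t l ih =>
    obtain ⟨d, h1, h2⟩ := h
    exact ⟨d, h1, ih h2⟩

theorem IsStepPath.reverse {step : α → L → α → Prop} {l : List L} {a b : α}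
    (h : IsStepPath step a l b) : IsStepPath (fun x t y => step y t x) b l.reverse a := by
  induction l generalizing a with
  | nil => exact Eq.symm h
  | cons t l ih =>
    obtain ⟨d, h1, h2⟩ := h
    rw [List.reverse_cons]
    exact (ih h2).append ⟨a, h1, rfl⟩

variable [DecidableEq L] {step : α → L → α → Prop}
  (hdet : ∀ a t b b', step a t b → step a t b' → b = b')
  (hdia : ∀ a s t b b', s ≠ t → step a s b → step a t b' → ∃ c, step b t c ∧ step b' s c)

include hdet hdia

/-- The step `s` is pushed along the path by diamonds until it meets the first letter `s`, where
determinism cancels the two. -/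
theorem IsStepPath.exchange_step {a b c : α} {s : L} {w : List L} (hs : step a s b)
    (hw : IsStepPath step a w c) :
    (s ∉ w ∧ ∃ e, step c s e ∧ IsStepPath step b w e) ∨
      (s ∈ w ∧ IsStepPath step b (w.erase s) c) := by
  induction w generalizing a b with
  | nil => cases hw; exact Or.inl ⟨by simp, b, hs, rfl⟩
  | cons t w ih =>
    obtain ⟨a', h1, h2⟩ := hw
    by_cases hst : s = t
    · subst hst
      rw [hdet _ _ _ _ hs h1]
      exact Or.inr ⟨by simp, by simpa using h2⟩
    · obtain ⟨u, h3, h4⟩ := hdia _ _ _ _ _ hst hs h1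
      rcases ih h4 h2 with ⟨h5, e, h6, h7⟩ | ⟨h5, h6⟩
      · exact Or.inl ⟨by simp [hst, h5], e, h6, u, h3, h7⟩
      · refine Or.inr ⟨by simp [h5], ?_⟩
        rw [List.erase_cons_tail (by simpa using Ne.symm hst)]
        exact ⟨u, h3, h6⟩

/-- Two paths with the same start can be continued to a common end, by the transitions
that are missing in the one and in the other path. -/
theorem IsStepPath.exchange {a b c : α} {w₁ w₂ : List L} (h₁ : IsStepPath step a w₁ b)
    (h₂ : IsStepPath step a w₂ c) : ∃ e v₁ v₂, IsStepPath step b v₁ e ∧ IsStepPath step c v₂ e ∧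
      (∀ t, v₁.count t = w₂.count t - w₁.count t) ∧
      ∀ t, v₂.count t = w₁.count t - w₂.count t := by
  induction w₁ generalizing a c w₂ with
  | nil => cases h₁; exact ⟨c, w₂, [], h₂, rfl, by simp, by simp⟩
  | cons s w₁ ih =>
    obtain ⟨a', hs, h₁⟩ := h₁
    rcases IsStepPath.exchange_step hdet hdia hs h₂ with ⟨h3, e, h4, h5⟩ | ⟨h3, h4⟩
    · obtain ⟨e', v₁, v₂, h6, h7, h8, h9⟩ := ih h₁ h5
      refine ⟨e', v₁, s :: v₂, h6, ⟨e, h4, h7⟩, fun t => ?_, fun t => ?_⟩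
      · rw [h8, List.count_cons]
        by_cases hst : s = t
        · subst hst
          rw [List.count_eq_zero_of_not_mem h3]; simp
        · simp [hst]
      · rw [List.count_cons, List.count_cons, h9]
        by_cases hst : s = t
        · subst hst
          rw [List.count_eq_zero_of_not_mem h3]; simp
        · simp [hst]
    · obtain ⟨e', v₁, v₂, h6, h7, h8, h9⟩ := ih h₁ h4
      have hpos : 0 < w₂.count s := List.count_pos_iff.2 h3
      refine ⟨e', v₁, v₂, h6, h7, fun t => ?_, fun t => ?_⟩
      · rw [h8, List.count_cons, List.count_erase]
        by_cases hst : s = t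
        · subst hst; simp; omega
        · simp [hst]
      · rw [h9, List.count_cons, List.count_erase]
        by_cases hst : s = t
        · subst hst; simp; omega
        · simp [hst]

end Diamond

namespace PlaneTriangulation

/-! ### Flips as commuting transitions -/

section Flips

open scoped Classical

variable {V : Type u} [Fintype V] [DecidableEq V] {G : PlaneTriangulation V}

theorem IsDirectedTriangle.eq_of_mem_of_eq {t : Finset V} {C C' : Set G.graph.Dart}
    (h : G.IsDirectedTriangle t C) (h' : G.IsDirectedTriangle t C') {d : G.graph.Dart}
    (hd : d ∈ C) (hd' : d ∈ C') : C = C' := by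
  obtain ⟨d₂, d₃, htri, rfl, rfl⟩ := exists_tri_of_mem h hd
  obtain ⟨e₂, e₃, htri', rfl, ht⟩ := exists_tri_of_mem h' hd'
  have h1 : d₃.fst ∈ ({d.fst, d₂.fst, d₃.fst} : Finset V) := by simp
  rw [ht] at h1
  simp only [Finset.mem_insert, Finset.mem_singleton] at h1
  rcases h1 with h1 | h1 | h1
  · exact absurd h1.symm htri.fst_ne.2.2
  · rw [← htri'.1, htri.1] at h1
    exact absurd h1.symm htri.fst_ne.2.1
  · obtain ⟨rfl, rfl⟩ := htri.eq_of_apex htri' h1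
    rfl

theorem IsDirectedTriangle.mem_or_symm_mem {t : Finset V} {C : Set G.graph.Dart}
    (h : G.IsDirectedTriangle t C) {e : G.graph.Dart} (he : e.fst ∈ t) (he' : e.snd ∈ t) :
    e ∈ C ∨ e.symm ∈ C := by
  obtain ⟨d, hd, hde⟩ := h.exists_fst he
  obtain ⟨d₂, d₃, htri, rfl, rfl⟩ := exists_tri_of_mem h hd
  simp only [Finset.mem_insert, Finset.mem_singleton] at he'
  rcases he' with h1 | h1 | h1
  · exact absurd (hde.symm.trans h1.symm) e.fst_ne_snd
  · left
    rw [← dart_eq hde (htri.1.trans h1.symm)]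
    exact hd
  · right
    rw [show e.symm = d₃ from dart_eq h1 (hde.symm.trans htri.2.2.symm)]
    simp

theorem IsDirectedTriangle.eq_or_eq_rev {t : Finset V} {C C' : Set G.graph.Dart}
    (h : G.IsDirectedTriangle t C) (h' : G.IsDirectedTriangle t C') : C = C' ∨ rev C = C' := by
  obtain ⟨e, he⟩ := h'.nonempty
  rcases h.mem_or_symm_mem (h'.fst_mem he).1 (h'.fst_mem he).2 with h1 | h1
  · exact Or.inl (h.eq_of_mem_of_eq h' h1 he)
  · exact Or.inr ((isDirectedTriangle_rev h).eq_of_mem_of_eq h' h1 he)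

/-- Uniqueness of potentials would make one indicator function the negative of another. -/
theorem not_isCounterclockwise_rev {t : Finset V} {C : Set G.graph.Dart}
    (h : G.IsDirectedTriangle t C) (hC : G.IsCounterclockwise C) :
    ¬ G.IsCounterclockwise (rev C) := by
  intro hC'
  obtain ⟨S, ho, rfl⟩ := isCounterclockwise_iff.1 hC
  obtain ⟨S', ho', hS'⟩ := isCounterclockwise_iff.1 hC'
  have := potential_unique (p := ind S) (q := fun f => - ind S' f) (by simp [ind, ho, ho'])
    (fun d => by
      have := ind_sub S' d
      rw [← hS'] at this
      simp only [mem_rev, SimpleGraph.Dart.symm_symm] at this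
      have h2 := ind_sub S d
      linarith)
  obtain ⟨d, hd⟩ := h.nonempty
  have h1 := congrFun this (G.left d)
  have h2 : d ∈ G.bd S := hd
  simp only [ind, if_pos h2.1] at h1
  split_ifs at h1
  norm_num at h1

theorem IsDirectedTriangle.eq_of_ccw {t : Finset V} {C C' : Set G.graph.Dart}
    (h : G.IsDirectedTriangle t C) (h' : G.IsDirectedTriangle t C')
    (hC : G.IsCounterclockwise C) (hC' : G.IsCounterclockwise C') : C = C' := by
  rcases h.eq_or_eq_rev h' with h1 | h1
  · exact h1
  · exact absurd (h1 ▸ hC') (not_isCounterclockwise_rev h hC)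

theorem IsDirectedTriangle.verts_eq {t t' : Finset V} {C : Set G.graph.Dart}
    (h : G.IsDirectedTriangle t C) (h' : G.IsDirectedTriangle t' C) : t = t' := by
  ext v
  constructor
  · intro hv
    obtain ⟨d, hd, rfl⟩ := h.exists_fst hv
    exact (h'.fst_mem hd).1
  · intro hv
    obtain ⟨d, hd, rfl⟩ := h'.exists_fst hv
    exact (h.fst_mem hd).1

theorem IsDirectedTriangle.card_fst {t : Finset V} {C : Set G.graph.Dart}
    (h : G.IsDirectedTriangle t C) (v : V) :
    {d ∈ C | d.fst = v}.ncard = {d ∈ rev C | d.fst = v}.ncard := by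
  have h1 := h.div_indicator v
  have h2 : div (fun d => if d ∈ C then (1 : ℤ) else 0) v =
      ∑ d : G.graph.Dart, (if d ∈ C ∧ d.fst = v then 1 else 0) -
        ∑ d : G.graph.Dart, (if d ∈ rev C ∧ d.fst = v then 1 else 0) := by
    rw [div, ← Finset.sum_sub_distrib]
    refine Finset.sum_congr rfl (fun d _ => ?_)
    by_cases hd : d.fst = v <;> simp [hd, mem_rev]
  rw [h2, Finset.sum_boole, Finset.sum_boole, sub_eq_zero] at h1
  rw [Set.ncard_eq_toFinset_card', Set.ncard_eq_toFinset_card']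
  have h3 : ∀ D : Set G.graph.Dart, {d ∈ D | d.fst = v}.toFinset =
      Finset.univ.filter (fun d => d ∈ D ∧ d.fst = v) := by
    intro D; ext d; simp
  rw [h3, h3]
  exact_mod_cast h1

namespace ThreeOrientation

theorem ext_arcs {T T' : G.ThreeOrientation} (h : T.arcs = T'.arcs) : T = T' := by
  cases T; cases T'; cases h; rfl

theorem ncard_flip (T : G.ThreeOrientation) {t : Finset V} {C : Set G.graph.Dart}
    (h : G.IsDirectedTriangle t C) (hC : C ⊆ T.arcs) (v : V) :
    {d ∈ (T.arcs \ C) ∪ rev C | d.fst = v}.ncard = {d ∈ T.arcs | d.fst = v}.ncard := by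
  have h1 : {d ∈ (T.arcs \ C) ∪ rev C | d.fst = v} =
      ({d ∈ T.arcs | d.fst = v} \ {d ∈ C | d.fst = v}) ∪ {d ∈ rev C | d.fst = v} := by
    ext d
    simp only [Set.mem_union, Set.mem_ofPred_eq, Set.mem_sdiff]
    tauto
  rw [h1, Set.ncard_union_eq, ← h.card_fst, Set.ncard_sdiff_add_ncard_of_subset]
  · exact fun d hd => ⟨hC hd.1, hd.2⟩
  · rw [Set.disjoint_left]
    rintro d ⟨h2, -⟩ ⟨h3, -⟩
    exact T.symm_notMem h2.1 (hC h3)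

/-- The 3-orientation that arises by reversing a directed triangle. -/
def flip (T : G.ThreeOrientation) {t : Finset V} {C : Set G.graph.Dart}
    (h : G.IsDirectedTriangle t C) (hC : C ⊆ T.arcs) : G.ThreeOrientation where
  arcs := (T.arcs \ C) ∪ rev C
  inner_edge d hd := by
    have h1 := T.inner_edge d hd
    have h2 := @hC d
    have h3 := @hC d.symm
    simp only [Set.mem_union, Set.mem_sdiff, mem_rev, SimpleGraph.Dart.symm_symm]
    tauto
  outer_edge d hd := by
    rintro (h1 | h1)
    · exact T.outer_edge d hd h1.1
    · exact T.outer_edge _ (IsOuterDart.symm hd) (hC h1)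
  inner_vertex v hv := by rw [T.ncard_flip h hC]; exact T.inner_vertex v hv
  outer_vertex v hv := by rw [T.ncard_flip h hC]; exact T.outer_vertex v hv

theorem arcs_of_flip {T T' : G.ThreeOrientation} {C : Set G.graph.Dart} (hC : C ⊆ T.arcs)
    (h : T'.arcs = (T.arcs \ C) ∪ rev C) :
    rev C ⊆ T'.arcs ∧ T.arcs = (T'.arcs \ rev C) ∪ C := by
  rw [h]
  refine ⟨Set.subset_union_right, ?_⟩
  ext d
  have h1 := @hC d
  have h2 := @hC d.symm
  have h3 := @T.symm_notMem _ _ _ _ d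
  simp only [Set.mem_union, Set.mem_sdiff, mem_rev]
  tauto

theorem isFlip_of_ccw {T T' : G.ThreeOrientation} {t : Finset V} (h : T.IsCcwFlip t T') :
    T.IsFlip t T' := by
  obtain ⟨C, h1, -, h2, h3⟩ := h
  exact ⟨C, h1, h2, h3⟩

theorem IsFlip.symm {T T' : G.ThreeOrientation} {t : Finset V} (h : T.IsFlip t T') :
    T'.IsFlip t T := by
  obtain ⟨C, h1, h2, h3⟩ := h
  obtain ⟨h4, h5⟩ := arcs_of_flip h2 h3
  refine ⟨rev C, isDirectedTriangle_rev h1, h4, ?_⟩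
  rw [h5]
  rfl

theorem ccw_or_of_isFlip {T T' : G.ThreeOrientation} {t : Finset V} (h : T.IsFlip t T') :
    T.IsCcwFlip t T' ∨ T'.IsCcwFlip t T := by
  obtain ⟨C, h1, h2, h3⟩ := h
  obtain ⟨h4, h5⟩ := arcs_of_flip h2 h3
  rcases h1.isCounterclockwise_or with hc | hc
  · exact Or.inl ⟨C, h1, hc, h2, h3⟩
  · refine Or.inr ⟨rev C, isDirectedTriangle_rev h1, hc, h4, ?_⟩
    rw [h5]
    rfl

theorem IsCcwFlip.det {T S S' : G.ThreeOrientation} {t : Finset V} (h : T.IsCcwFlip t S)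
    (h' : T.IsCcwFlip t S') : S = S' := by
  obtain ⟨C, h1, hc, h2, h3⟩ := h
  obtain ⟨C', h1', hc', h2', h3'⟩ := h'
  obtain rfl := h1.eq_of_ccw h1' hc hc'
  exact ext_arcs (h3.trans h3'.symm)

theorem IsCcwFlip.det_symm {T S S' : G.ThreeOrientation} {t : Finset V} (h : S.IsCcwFlip t T)
    (h' : S'.IsCcwFlip t T) : S = S' := by
  obtain ⟨C, h1, hc, h2, h3⟩ := h
  obtain ⟨C', h1', hc', h2', h3'⟩ := h'
  obtain rfl := h1.eq_of_ccw h1' hc hc'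
  exact ext_arcs ((arcs_of_flip h2 h3).2.trans (arcs_of_flip h2' h3').2.symm)

/-- By rigidity the two triangles share no dart, so each survives the flip of the other. -/
theorem IsCcwFlip.diamond {T S S' : G.ThreeOrientation} {s t : Finset V} (hst : s ≠ t)
    (h : T.IsCcwFlip s S) (h' : T.IsCcwFlip t S') :
    ∃ U : G.ThreeOrientation, S.IsCcwFlip t U ∧ S'.IsCcwFlip s U := by
  obtain ⟨C, h1, hc, h2, h3⟩ := h
  obtain ⟨C', h1', hc', h2', h3'⟩ := h'
  have hdisj : ∀ d ∈ C, d ∉ C' := by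
    intro d hd hd'
    obtain rfl := h1.eq_of_mem h1' hc hc' h2 h2' hd hd'
    exact hst (h1.verts_eq h1')
  have hsub : C' ⊆ S.arcs := by
    rw [h3]
    exact fun d hd => Or.inl ⟨h2' hd, fun h => hdisj d h hd⟩
  have hsub' : C ⊆ S'.arcs := by
    rw [h3']
    exact fun d hd => Or.inl ⟨h2 hd, fun h => hdisj d hd h⟩
  refine ⟨S.flip h1' hsub, ⟨C', h1', hc', hsub, rfl⟩, ⟨C, h1, hc, hsub', ?_⟩⟩
  change (S.arcs \ C') ∪ rev C' = (S'.arcs \ C) ∪ rev C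
  rw [h3, h3']
  ext d
  have a1 := hdisj d
  have a2 := @h2 d
  have a3 := @h2' d
  have a4 := @h2 d.symm
  have a5 := @h2' d.symm
  have a6 := @T.symm_notMem _ _ _ _ d
  change ((d ∈ T.arcs ∧ d ∉ C ∨ d.symm ∈ C) ∧ d ∉ C' ∨ d.symm ∈ C') ↔
    ((d ∈ T.arcs ∧ d ∉ C' ∨ d.symm ∈ C') ∧ d ∉ C ∨ d.symm ∈ C)
  tauto

/-- Here the triangles are directed counterclockwise in different orientations `S` and `S'`, which
is why `IsDirectedTriangle.eq_of_mem` allows two of them. -/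
theorem IsCcwFlip.diamond_symm {T S S' : G.ThreeOrientation} {s t : Finset V} (hst : s ≠ t)
    (h : S.IsCcwFlip s T) (h' : S'.IsCcwFlip t T) :
    ∃ U : G.ThreeOrientation, U.IsCcwFlip t S ∧ U.IsCcwFlip s S' := by
  obtain ⟨C, h1, hc, h2, h3⟩ := h
  obtain ⟨C', h1', hc', h2', h3'⟩ := h'
  have hdisj : ∀ d ∈ C, d ∉ C' := by
    intro d hd hd'
    obtain rfl := h1.eq_of_mem h1' hc hc' h2 h2' hd hd'
    exact hst (h1.verts_eq h1')
  obtain ⟨b1, b2⟩ := arcs_of_flip h2 h3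
  obtain ⟨b1', b2'⟩ := arcs_of_flip h2' h3'
  have hsub : rev C' ⊆ S.arcs := by
    rw [b2]
    exact fun d hd => Or.inl ⟨b1' hd, fun h => hdisj _ h hd⟩
  have key : ∀ d : G.graph.Dart, (d ∈ C → d ∉ C') ∧ (d.symm ∈ C → d.symm ∉ C') ∧
      (d.symm ∈ C → d ∈ T.arcs) ∧ (d.symm ∈ C' → d ∈ T.arcs) ∧
      (d ∈ C → d.symm ∈ T.arcs) ∧ (d ∈ C' → d.symm ∈ T.arcs) ∧
      (d ∈ T.arcs → d.symm ∉ T.arcs) := by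
    intro d
    refine ⟨hdisj d, hdisj d.symm, @b1 d, @b1' d, fun h => b1 ?_, fun h => b1' ?_,
      fun h => T.symm_notMem h⟩
    · simpa [mem_rev] using h
    · simpa [mem_rev] using h
  have hS : ∀ d, d ∈ S.arcs ↔ (d ∈ T.arcs ∧ ¬ d.symm ∈ C) ∨ d ∈ C := fun d => by rw [b2]; rfl
  have hS' : ∀ d, d ∈ S'.arcs ↔ (d ∈ T.arcs ∧ ¬ d.symm ∈ C') ∨ d ∈ C' := fun d => by
    rw [b2']; rfl
  set U := S.flip (isDirectedTriangle_rev h1') hsub with hUdef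
  have hU : ∀ d, d ∈ U.arcs ↔ (d ∈ S.arcs ∧ ¬ d.symm ∈ C') ∨ d ∈ C' := by
    intro d
    change (d ∈ S.arcs ∧ ¬ d.symm ∈ C') ∨ d ∈ rev (rev C') ↔ _
    rw [rev_rev]
  refine ⟨U, ⟨C', h1', hc', ?_, ?_⟩, ⟨C, h1, hc, ?_, ?_⟩⟩
  · intro d hd
    exact (hU d).2 (Or.inr hd)
  · ext d
    obtain ⟨k1, k2, k3, k4, k5, k6, k7⟩ := key d
    change d ∈ S.arcs ↔ (d ∈ U.arcs ∧ d ∉ C') ∨ d.symm ∈ C'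
    rw [hU, hS]
    clear * - k1 k2 k3 k4 k5 k6 k7
    by_cases a1 : d ∈ C <;> by_cases a2 : d.symm ∈ C <;> by_cases a3 : d ∈ C' <;>
      by_cases a4 : d.symm ∈ C' <;> by_cases a5 : d ∈ T.arcs <;> simp_all
  · intro d hd
    obtain ⟨k1, k2, k3, k4, k5, k6, k7⟩ := key d
    rw [hU, hS]
    clear * - k1 k2 k3 k4 k5 k6 k7 hd
    by_cases a1 : d ∈ C <;> by_cases a2 : d.symm ∈ C <;> by_cases a3 : d ∈ C' <;>
      by_cases a4 : d.symm ∈ C' <;> by_cases a5 : d ∈ T.arcs <;> simp_all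
  · ext d
    obtain ⟨k1, k2, k3, k4, k5, k6, k7⟩ := key d
    change d ∈ S'.arcs ↔ (d ∈ U.arcs ∧ d ∉ C) ∨ d.symm ∈ C
    rw [hU, hS, hS']
    clear * - k1 k2 k3 k4 k5 k6 k7
    by_cases a1 : d ∈ C <;> by_cases a2 : d.symm ∈ C <;> by_cases a3 : d ∈ C' <;>
      by_cases a4 : d.symm ∈ C' <;> by_cases a5 : d ∈ T.arcs <;> simp_all

theorem isCcwFlipSequence_iff {T T' : G.ThreeOrientation} {l : List (Finset V)} :
    T.IsCcwFlipSequence l T' ↔ IsStepPath IsCcwFlip T l T' := by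
  constructor
  · intro h
    induction h with
    | nil T => rfl
    | cons h1 _ ih => exact ⟨_, h1, ih⟩
  · intro h
    induction l generalizing T with
    | nil => cases h; exact .nil _
    | cons t l ih =>
      obtain ⟨S, h1, h2⟩ := h
      exact .cons h1 (ih h2)

theorem isFlipSequence_iff {T T' : G.ThreeOrientation} {l : List (Finset V)} :
    T.IsFlipSequence l T' ↔ IsStepPath IsFlip T l T' := by
  constructor
  · intro h
    induction h with
    | nil T => rfl
    | cons h1 _ ih => exact ⟨_, h1, ih⟩
  · intro h
    induction l generalizing T with
    | nil => cases h; exact .nil _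
    | cons t l ih =>
      obtain ⟨S, h1, h2⟩ := h
      exact .cons h1 (ih h2)

end ThreeOrientation

end Flips

end PlaneTriangulation

namespace PlaneTriangulation

section Facial

open scoped Classical

variable {V : Type u} [Fintype V] [DecidableEq V] {G : PlaneTriangulation V}

/-! ### Facial and separating triangles -/

/-- The faces touching `X` can border other faces only along edges of the facial triangle, so their
boundary is that whole triangle, seen from outside. -/
theorem bd_touching_component {d : G.graph.Dart} {t : Finset V}
    (ht : t = {d.fst, (G.emb.facePerm d).fst, (G.emb.facePerm (G.emb.facePerm d)).fst})
    {X : Set V} (hne : X.Nonempty) (hXt : ∀ v ∈ X, v ∉ t)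
    (hX : ∀ x ∈ X, ∀ y, G.graph.Adj x y → y ∉ t → y ∈ X) :
    d.symm ∈ G.bd {f | ∃ e : G.graph.Dart, G.left e = f ∧ e.fst ∈ X} := by
  set C : Set G.graph.Dart := {d, G.emb.facePerm d, G.emb.facePerm (G.emb.facePerm d)} with hC
  set F : Set G.emb.Face := {f | ∃ e : G.graph.Dart, G.left e = f ∧ e.fst ∈ X} with hF
  have h : G.IsDirectedTriangle t C := isDirectedTriangle_iff.2
    ⟨_, _, _, ⟨(facePerm_fst _).symm, facePerm_snd d, facePerm_facePerm_snd d⟩, rfl, ht⟩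
  have hd : G.left d ∉ F := by
    rintro ⟨e, he, heX⟩
    refine hXt _ heX ?_
    rw [ht]
    rcases left_eq_left_iff.1 he with rfl | rfl | rfl <;> simp
  have hcut := h.cut (A := F) (by
    rintro e ⟨h1, h2⟩
    have n1 : e.fst ∉ X := fun hx => h2 ⟨G.emb.facePerm e.symm, left_facePerm _, by
      rw [facePerm_fst]; exact hx⟩
    have n2 : e.snd ∉ X := fun hx => h2 ⟨e.symm, rfl, hx⟩
    obtain ⟨e', he', hx⟩ := h1
    rcases left_eq_left_iff.1 he' with rfl | rfl | rfl
    · exact absurd hx n1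
    · rw [facePerm_fst] at hx
      exact absurd hx n2
    · have a1 := (G.emb.facePerm (G.emb.facePerm e)).adj
      rw [facePerm_facePerm_snd] at a1
      have a2 := (G.emb.facePerm e).adj
      rw [facePerm_fst, facePerm_snd] at a2
      refine h.mem_or_symm_mem ?_ ?_
      · by_contra hc; exact n1 (hX _ hx _ a1 hc)
      · by_contra hc; exact n2 (hX _ hx _ a2.symm hc))
  rcases hcut with h1 | h1 | h1
  · have : d ∈ G.bd F := by rw [h1]; simp [C]
    exact absurd this.1 hd
  · rw [h1, mem_rev, SimpleGraph.Dart.symm_symm]; simp [C]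
  · rcases bd_eq_empty h1 with h2 | h2
    · obtain ⟨v, hv⟩ := hne
      obtain ⟨e, rfl⟩ := exists_dart_fst (G := G) v
      have : G.left e ∈ F := ⟨e, rfl, hv⟩
      rw [h2] at this
      exact absurd this (Set.notMem_empty _)
    · exact absurd (h2 ▸ Set.mem_univ _) hd

/-- The face across `d` touches every component of the complement of `t`. Its vertices are pairwise
adjacent, so there is only one component. -/
theorem not_isSeparatingTriangle_of_isFacial {t : Finset V} (ht : G.IsFacial t) :
    ¬ G.IsSeparatingTriangle t := by
  rintro ⟨-, h⟩
  obtain ⟨d, ht⟩ := ht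
  refine h (fun a b => ?_)
  let H := G.graph.induce {v | v ∉ t}
  let X : {v | v ∉ t} → Set V := fun a => {v | ∃ hv : v ∉ t, H.Reachable a ⟨v, hv⟩}
  have hX : ∀ a, d.symm ∈ G.bd {f | ∃ e : G.graph.Dart, G.left e = f ∧ e.fst ∈ X a} := by
    intro a
    refine bd_touching_component ht ⟨a.1, a.2, SimpleGraph.Reachable.refl _⟩ (fun v hv => hv.1) ?_
    rintro x ⟨hx, hr⟩ y hxy hy
    refine ⟨hy, hr.trans (SimpleGraph.Adj.reachable ?_)⟩
    exact hxy
  obtain ⟨e, he, hex, hra⟩ := (hX a).1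
  obtain ⟨e', he', hex', hrb⟩ := (hX b).1
  refine hra.trans (SimpleGraph.Reachable.trans ?_ hrb.symm)
  have hadj : e.fst = e'.fst ∨ G.graph.Adj e.fst e'.fst := by
    rcases left_eq_left_iff.1 (he'.trans he.symm) with rfl | rfl | rfl
    · exact Or.inl rfl
    · rw [facePerm_fst]; exact Or.inr e.adj
    · have := (G.emb.facePerm (G.emb.facePerm e)).adj
      rw [facePerm_facePerm_snd] at this
      exact Or.inr this.symm
  rcases hadj with h1 | h1
  · have : (⟨e.fst, hex⟩ : {v | v ∉ t}) = ⟨e'.fst, hex'⟩ := Subtype.ext h1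
    rw [this]
  · exact SimpleGraph.Adj.reachable (G := H) h1

theorem eq_facePerm {d e : G.graph.Dart} (h : G.left e = G.left d) (h' : d.snd = e.fst) :
    e = G.emb.facePerm d := by
  rcases left_eq_left_iff.1 h with rfl | rfl | rfl
  · exact absurd h'.symm e.fst_ne_snd
  · rfl
  · rw [← facePerm_fst, ← facePerm_snd] at h'
    exact absurd h' (SimpleGraph.Dart.fst_ne_snd _)

/-- Without interior vertices the region would be a single face. On the other side lies an outer
vertex: it is not on the triangle, since outer vertices have no outgoing arcs. -/
theorem ThreeOrientation.isSeparatingTriangle_of_not_isFacial (T : G.ThreeOrientation)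
    {t : Finset V} {C : Set G.graph.Dart} (h : G.IsDirectedTriangle t C)
    (hC : G.IsCounterclockwise C) (hT : C ⊆ T.arcs) (ht : ¬ G.IsFacial t) :
    G.IsSeparatingTriangle t := by
  obtain ⟨S, ho, hS⟩ := isCounterclockwise_iff.1 hC
  have hin : (G.vint S).Nonempty := by
    by_contra hc
    rw [Set.not_nonempty_iff_eq_empty] at hc
    have h1 := (h.card_region hS.symm).1
    rw [hc, Set.ncard_empty] at h1
    obtain ⟨f, hf⟩ := Set.ncard_eq_one.1 h1
    have hleft : ∀ e ∈ C, G.left e = f := by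
      intro e he
      rw [hS] at he
      have := he.1
      rw [hf] at this
      exact this
    obtain ⟨d, d₂, d₃, htri, rfl, rfl⟩ := isDirectedTriangle_iff.1 h
    have e0 := hleft d (by simp)
    have e1 := eq_facePerm ((hleft d₂ (by simp)).trans e0.symm) htri.1
    have e2 := eq_facePerm ((hleft d₃ (by simp)).trans (hleft d₂ (by simp)).symm) htri.2.1
    exact ht ⟨d, by rw [e2, e1]⟩
  obtain ⟨o, hoV, -⟩ := exists_isOuterVertex_ne (G := G) h.nonempty.some.fst
  have hot : o ∉ t := by
    intro hot
    obtain ⟨d, hd, hdo⟩ := h.exists_fst hot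
    have := T.outer_vertex o hoV
    rw [Set.ncard_eq_zero] at this
    exact Set.notMem_empty d (this ▸ (⟨hT hd, hdo⟩ : d ∈ {d ∈ T.arcs | d.fst = o}))
  have hov : o ∈ G.vint Sᶜ := (h.vint_or hS.symm hot).resolve_left
    (fun h1 => not_isOuterVertex_of_vint ho h1 hoV)
  obtain ⟨x, hx⟩ := hin
  have hxt : x ∉ t := fun h1 => (h.notMem_vint hS.symm h1).1 hx
  constructor
  · obtain ⟨d₁, d₂, d₃, htri, rfl, rfl⟩ := isDirectedTriangle_iff.1 h
    rw [SimpleGraph.is3Clique_iff]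
    refine ⟨_, _, _, ?_, ?_, ?_, rfl⟩
    · rw [← htri.1]; exact d₁.adj
    · rw [← htri.2.2]; exact d₃.adj.symm
    · rw [← htri.2.1]; exact d₂.adj
  · intro hpre
    obtain ⟨p⟩ := hpre ⟨x, hxt⟩ ⟨o, hot⟩
    have key : ∀ {a b : {v | v ∉ t}}, (G.graph.induce {v | v ∉ t}).Walk a b →
        a.1 ∈ G.vint S → b.1 ∈ G.vint S := by
      intro a b p
      induction p with
      | nil => exact id
      | @cons a c b hac p ih =>
        intro ha
        refine ih ((h.vint_or hS.symm c.2).resolve_right (fun hc => ?_))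
        let d : G.graph.Dart := ⟨(a.1, c.1), hac⟩
        have h1 := (mem_inn_of_vint (d := d) ha).2
        exact (mem_inn_of_vint (d := d.symm) hc).1 h1
    exact (disjoint_vint S).le_bot ⟨key p hx, hov⟩

end Facial

/-! ### Heights, the minimum and the number of flips -/

section Height

open scoped Classical

variable {V : Type u} [Fintype V] [DecidableEq V] {G : PlaneTriangulation V}

namespace ThreeOrientation

/-! ### The height function of a pair of 3-orientations -/

/-- Indicator function of the arcs. -/
noncomputable def arcInd (T : G.ThreeOrientation) (d : G.graph.Dart) : ℤ :=
  if d ∈ T.arcs then 1 else 0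

theorem sum_arcInd (T : G.ThreeOrientation) (v : V) :
    (∑ d : G.graph.Dart, if d.fst = v then T.arcInd d else 0) =
      if G.IsOuterVertex v then 0 else 3 := by
  have h1 : (∑ d : G.graph.Dart, if d.fst = v then T.arcInd d else 0) =
      (({d ∈ T.arcs | d.fst = v}.ncard : ℕ) : ℤ) := by
    have h2 : ∀ d : G.graph.Dart, (if d.fst = v then T.arcInd d else 0) =
        if d ∈ T.arcs ∧ d.fst = v then 1 else 0 := by
      intro d
      by_cases a1 : d ∈ T.arcs <;> by_cases a2 : d.fst = v <;> simp [arcInd, a1, a2]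
    rw [Finset.sum_congr rfl (fun d _ => h2 d), Finset.sum_boole, Set.ncard_eq_toFinset_card']
    congr 2
    ext d
    simp
  rw [h1]
  split_ifs with h
  · rw [T.outer_vertex v h]; rfl
  · rw [T.inner_vertex v h]; rfl

theorem exists_height (T T' : G.ThreeOrientation) : ∃ q : G.emb.Face → ℤ, q G.outer = 0 ∧
    ∀ d, T.arcInd d - T'.arcInd d = q (G.left d) - q (G.right d) := by
  -- `exists_potential` antisymmetrizes its input. Feeding it `T.arcInd - T'.arcInd`, already
  -- antisymmetric, would double the height; the indicator of the reversed arcs avoids this.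
  have hx : ∀ d : G.graph.Dart, (if d ∈ T.arcs ∧ d ∉ T'.arcs then (1 : ℤ) else 0) -
      (if d.symm ∈ T.arcs ∧ d.symm ∉ T'.arcs then 1 else 0) = T.arcInd d - T'.arcInd d := by
    intro d
    by_cases hd : G.IsOuterDart d
    · have a1 := T.outer_edge d hd
      have a2 := T.outer_edge _ (IsOuterDart.symm hd)
      have a3 := T'.outer_edge d hd
      simp [arcInd, a1, a2, a3]
    · have a1 := T.inner_edge d hd
      have a2 := T'.inner_edge d hd
      by_cases b1 : d ∈ T.arcs <;> by_cases b2 : d ∈ T'.arcs <;> simp_all [arcInd]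
  obtain ⟨q, h0, hq⟩ := exists_potential
    (fun d => if d ∈ T.arcs ∧ d ∉ T'.arcs then (1 : ℤ) else 0) (fun v => by
      simp only [div, hx]
      have := (T.sum_arcInd v).trans (T'.sum_arcInd v).symm
      rw [← sub_eq_zero, ← Finset.sum_sub_distrib] at this
      refine Eq.trans ?_ this
      refine Finset.sum_congr rfl (fun d _ => ?_)
      split_ifs <;> simp)
  exact ⟨q, h0, fun d => (hx d).symm.trans (hq d)⟩

/-- The face potential of the difference of two 3-orientations. -/
noncomputable def height (T T' : G.ThreeOrientation) : G.emb.Face → ℤ :=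
  (exists_height T T').choose

theorem height_outer (T T' : G.ThreeOrientation) : T.height T' G.outer = 0 :=
  (exists_height T T').choose_spec.1

theorem height_sub (T T' : G.ThreeOrientation) (d : G.graph.Dart) :
    T.height T' (G.left d) - T.height T' (G.right d) = T.arcInd d - T'.arcInd d :=
  ((exists_height T T').choose_spec.2 d).symm

theorem height_add (T T' T'' : G.ThreeOrientation) (f : G.emb.Face) :
    T.height T'' f = T.height T' f + T'.height T'' f := by
  have := potential_unique (p := T.height T'') (q := fun f => T.height T' f + T'.height T'' f)
    (by simp [height_outer]) (fun d => by
      have h1 := height_sub T T' d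
      have h2 := height_sub T' T'' d
      have h3 := height_sub T T'' d
      linarith)
  exact congrFun this f

theorem height_self (T : G.ThreeOrientation) (f : G.emb.Face) : T.height T f = 0 := by
  have := height_add T T T f
  linarith

theorem eq_of_height {T T' : G.ThreeOrientation} (h : ∀ f, T.height T' f = 0) : T = T' := by
  refine ext_arcs (Set.ext fun d => ?_)
  have := height_sub T T' d
  rw [h, h, arcInd, arcInd] at this
  by_cases h1 : d ∈ T.arcs <;> by_cases h2 : d ∈ T'.arcs <;> simp_all

theorem IsCcwFlip.height_eq {T T' : G.ThreeOrientation} {t : Finset V} (h : T.IsCcwFlip t T') :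
    ∃ S : Set G.emb.Face, S.Nonempty ∧ T.height T' = ind S := by
  obtain ⟨C, h1, hc, h2, h3⟩ := h
  obtain ⟨S, ho, rfl⟩ := isCounterclockwise_iff.1 hc
  obtain ⟨e, he⟩ := h1.nonempty
  refine ⟨S, ⟨_, he.1⟩, potential_unique (by simp [height_outer, ind, ho]) (fun d => ?_)⟩
  rw [height_sub, ind_sub]
  have a1 := @h2 d
  have a2 := @h2 d.symm
  have a3 := @T.symm_notMem _ _ _ _ d
  have a4 : d ∈ T'.arcs ↔ (d ∈ T.arcs ∧ d ∉ G.bd S) ∨ d.symm ∈ G.bd S := by rw [h3]; rfl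
  simp only [arcInd, a4]
  by_cases b1 : d ∈ T.arcs <;> by_cases b2 : d ∈ G.bd S <;> by_cases b3 : d.symm ∈ G.bd S <;>
    simp_all

theorem IsCcwFlip.height_pos {T T' : G.ThreeOrientation} {t : Finset V} (h : T.IsCcwFlip t T') :
    (∀ f, 0 ≤ T.height T' f) ∧ 1 ≤ ∑ f, T.height T' f := by
  obtain ⟨S, ⟨g, hg⟩, hS⟩ := h.height_eq
  have h1 : ∀ f, 0 ≤ T.height T' f := by
    intro f
    rw [hS, ind]
    split_ifs <;> simp
  refine ⟨h1, ?_⟩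
  calc (1 : ℤ) = T.height T' g := by rw [hS, ind, if_pos hg]
    _ ≤ _ := Finset.single_le_sum (fun f _ => h1 f) (Finset.mem_univ g)

theorem height_of_path {T T' : G.ThreeOrientation} {l : List (Finset V)}
    (h : IsStepPath IsCcwFlip T l T') :
    (∀ f, 0 ≤ T.height T' f) ∧ (l.length : ℤ) ≤ ∑ f, T.height T' f := by
  induction l generalizing T with
  | nil => cases h; simp [height_self]
  | cons t l ih =>
    obtain ⟨S, h1, h2⟩ := h
    obtain ⟨a1, a2⟩ := h1.height_pos
    obtain ⟨b1, b2⟩ := ih h2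
    simp only [height_add T S T', Finset.sum_add_distrib]
    refine ⟨fun f => add_nonneg (a1 f) (b1 f), ?_⟩
    push_cast [List.length_cons]
    linarith

/-- Heights of adjacent faces differ by at most one, so by dual connectivity all integers between
`0` and the height of `f` are attained, each by a different face. -/
theorem height_le (T T' : G.ThreeOrientation) (f : G.emb.Face) :
    T.height T' f ≤ Fintype.card G.emb.Face := by
  by_contra hc
  push Not at hc
  have hsub : Finset.Icc 0 (T.height T' f) ⊆ Finset.univ.image (T.height T') := by
    intro k hk
    rw [Finset.mem_Icc] at hk
    by_contra hn
    have hne : ∀ g, T.height T' g ≠ k := fun g hg =>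
      hn (Finset.mem_image.2 ⟨g, Finset.mem_univ g, hg⟩)
    have := face_connected (A := {g | k ≤ T.height T' g}) ⟨f, hk.2⟩ (fun d hd => by
      have h1 := height_sub T T' d
      have h2 : k ≤ T.height T' (G.left d) := hd
      have h3 := hne (G.left d)
      have h4 : T.arcInd d - T'.arcInd d ≤ 1 := by
        simp only [arcInd]; split_ifs <;> norm_num
      change k ≤ T.height T' (G.right d)
      omega) G.outer
    have h1 : k ≤ T.height T' G.outer := this
    have h2 := hne G.outer
    rw [height_outer] at h1 h2
    omega
  have h1 := (Finset.card_le_card hsub).trans Finset.card_image_le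
  rw [Int.card_Icc, Finset.card_univ] at h1
  omega

theorem sum_height_le (T T' : G.ThreeOrientation) :
    ∑ f, T.height T' f ≤ (Fintype.card G.emb.Face : ℤ) * Fintype.card G.emb.Face := by
  have := Finset.sum_le_card_nsmul Finset.univ (T.height T') _ (fun f _ => height_le T T' f)
  simpa using this

theorem length_le {T T' : G.ThreeOrientation} {l : List (Finset V)}
    (h : IsStepPath IsCcwFlip T l T') : l.length ≤ 4 * Fintype.card V ^ 2 := by
  have h1 := (height_of_path h).2.trans (sum_height_le T T')
  have h2 := card_face (G := G)
  have h3 : l.length ≤ Fintype.card G.emb.Face * Fintype.card G.emb.Face := by exact_mod_cast h1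
  have h4 : Fintype.card G.emb.Face ≤ 2 * Fintype.card V := by omega
  calc l.length ≤ _ := h3
    _ ≤ (2 * Fintype.card V) * (2 * Fintype.card V) := Nat.mul_le_mul h4 h4
    _ = _ := by ring

/-! ### The minimum -/

/-- No triangle is directed counterclockwise. -/
def IsTerminal (T : G.ThreeOrientation) : Prop :=
  ∀ (t : Finset V) (T' : G.ThreeOrientation), ¬ T.IsCcwFlip t T'

/-- The faces of positive height would form a directed cut, and `exists_ccw_triangle` would supply a
flip. -/
theorem IsTerminal.height_nonpos {T : G.ThreeOrientation} (h : T.IsTerminal)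
    (T' : G.ThreeOrientation) (f : G.emb.Face) : T.height T' f ≤ 0 := by
  by_contra hc
  push Not at hc
  obtain ⟨t, C, h1, h2, h3⟩ := T.exists_ccw_triangle (S₀ := {g | 0 < T.height T' g}) ⟨f, hc⟩
    (by simp [height_outer]) (by
      rintro d ⟨a1, a2⟩
      simp only [Set.mem_ofPred_eq, not_lt] at a1 a2
      have := height_sub T T' d
      by_contra h
      simp only [arcInd, if_neg h] at this
      split_ifs at this <;> omega)
  exact h t (T.flip h1 h3) ⟨C, h1, h2, h3, rfl⟩

theorem IsTerminal.unique {T T' : G.ThreeOrientation} (h : T.IsTerminal) (h' : T'.IsTerminal) :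
    T = T' := by
  refine eq_of_height (fun f => ?_)
  have h1 := h.height_nonpos T' f
  have h2 := h'.height_nonpos T f
  have h3 := height_add T T' T f
  rw [height_self] at h3
  omega

theorem exists_terminal (T : G.ThreeOrientation) :
    ∃ T₀ l, IsStepPath IsCcwFlip T l T₀ ∧ T₀.IsTerminal := by
  -- The total height relative to `T` is at least `-N` and drops with each flip, so adding `N` gives
  -- an induction measure.
  set N : ℤ := (Fintype.card G.emb.Face : ℤ) * Fintype.card G.emb.Face
  have key : ∀ n : ℕ, ∀ S : G.ThreeOrientation, ∑ f, S.height T f + N ≤ n →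
      ∃ T₀ l, IsStepPath IsCcwFlip S l T₀ ∧ T₀.IsTerminal := by
    intro n
    induction n with
    | zero =>
      intro S hS
      refine ⟨S, [], rfl, fun t S' hS' => ?_⟩
      have h1 := hS'.height_pos.2
      have h2 := sum_height_le T S'
      have h3 : ∑ f, T.height S' f + ∑ f, S.height T f = ∑ f, S.height S' f := by
        rw [← Finset.sum_add_distrib]
        exact Finset.sum_congr rfl (fun f _ => by rw [height_add S T S', add_comm])
      push_cast at hS
      linarith
    | succ n ih =>
      intro S hS
      by_cases ht : S.IsTerminal
      · exact ⟨S, [], rfl, ht⟩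
      · simp only [IsTerminal, not_forall, not_not] at ht
        obtain ⟨t, S', hS'⟩ := ht
        have h1 := hS'.height_pos.2
        have h3 : ∑ f, S.height T f = ∑ f, S.height S' f + ∑ f, S'.height T f := by
          rw [← Finset.sum_add_distrib]
          exact Finset.sum_congr rfl (fun f _ => height_add S S' T f)
        obtain ⟨T₀, l, h4, h5⟩ := ih S' (by push_cast at hS; linarith)
        exact ⟨T₀, t :: l, ⟨S', hS', h4⟩, h5⟩
  refine key (∑ f, T.height T f + N).toNat T ?_
  exact Int.self_le_toNat _

/-- A flip away from a minimum could be followed by a path back to it, a closed path of positive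
total height. Conversely, every orientation flows to some terminal one, and that one is unique. -/
theorem isMinimum_iff {T : G.ThreeOrientation} : T.IsMinimum ↔ T.IsTerminal := by
  constructor
  · intro h t T' hT'
    obtain ⟨l, hl⟩ := h T'
    have h1 := (height_of_path (isCcwFlipSequence_iff.1 hl)).1
    obtain ⟨h2, h3⟩ := hT'.height_pos
    have h4 : ∑ f, T.height T' f ≤ 0 := by
      refine Finset.sum_nonpos (fun f _ => ?_)
      have := height_add T T' T f
      rw [height_self] at this
      have := h1 f
      omega
    omega
  · intro h T'
    obtain ⟨T₀, l, h1, h2⟩ := exists_terminal T'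
    rw [h.unique h2]
    exact ⟨l, isCcwFlipSequence_iff.2 h1⟩

theorem exists_unique_minimum (T : G.ThreeOrientation) :
    ∃! T₀ : G.ThreeOrientation, T₀.IsMinimum := by
  obtain ⟨T₀, l, -, h⟩ := exists_terminal T
  exact ⟨T₀, isMinimum_iff.2 h, fun T' h' => (isMinimum_iff.1 h').unique h⟩

/-- No step leaves `T₀`, so both completions in the exchange lemma are empty and both truncated
differences of counts vanish. -/
theorem count_eq_count {T T₀ : G.ThreeOrientation} {l l' : List (Finset V)}
    (h₀ : T₀.IsTerminal) (h : IsStepPath IsCcwFlip T l T₀) (h' : IsStepPath IsCcwFlip T l' T₀)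
    (t : Finset V) : l.count t = l'.count t := by
  obtain ⟨e, v₁, v₂, h1, h2, h3, h4⟩ := IsStepPath.exchange
    (step := (IsCcwFlip : G.ThreeOrientation → _ → _ → Prop))
    (fun _ _ _ _ a b => a.det b) (fun _ _ _ _ _ n a b => a.diamond n b) h h'
  have hnil : ∀ v : List (Finset V), IsStepPath IsCcwFlip T₀ v e → v = [] := by
    intro v hv
    cases v with
    | nil => rfl
    | cons s v =>
      obtain ⟨c, hc, -⟩ := hv
      exact absurd hc (h₀ s c)
  have h5 := h3 t
  have h6 := h4 t
  rw [hnil v₁ h1, List.count_nil] at h5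
  rw [hnil v₂ h2, List.count_nil] at h6
  omega

theorem count_eq_potential {T T₀ : G.ThreeOrientation} {l : List (Finset V)}
    (h₀ : T₀.IsMinimum) (h : T.IsCcwFlipSequence l T₀) (t : Finset V) :
    l.count t = T.potential t := by
  have : {k | ∃ T₀ l, IsMinimum T₀ ∧ IsCcwFlipSequence T l T₀ ∧ l.count t = k} =
      {l.count t} := by
    ext k
    simp only [Set.mem_ofPred_eq, Set.mem_singleton_iff]
    constructor
    · rintro ⟨T₁, l', h1, h2, rfl⟩
      obtain rfl := (isMinimum_iff.1 h1).unique (isMinimum_iff.1 h₀)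
      exact count_eq_count (isMinimum_iff.1 h₀) (isCcwFlipSequence_iff.1 h2)
        (isCcwFlipSequence_iff.1 h) t
    · rintro rfl
      exact ⟨T₀, l, h₀, h, rfl⟩
  rw [potential, this, csInf_singleton]

/-! ### Facial flips -/

theorem IsCcwFlip.potential_eq {T T' : G.ThreeOrientation} {s t : Finset V}
    (h : T.IsCcwFlip s T') (hst : s ≠ t) : T.potential t = T'.potential t := by
  obtain ⟨T₀, h₀, -⟩ := exists_unique_minimum T
  obtain ⟨l, hl⟩ := h₀ T'
  rw [← count_eq_potential h₀ hl, ← count_eq_potential h₀ (.cons h hl),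
    List.count_cons_of_ne hst]

theorem potential_eq_of_facial {T T' : G.ThreeOrientation} {l : List (Finset V)}
    (h : T.IsFacialFlipSequence l T') {t : Finset V} (ht : G.IsSeparatingTriangle t) :
    T.potential t = T'.potential t := by
  obtain ⟨h, hl⟩ := h
  induction h with
  | nil => rfl
  | @cons T S T' s l hs _ ih =>
    have hne : s ≠ t := by
      rintro rfl
      exact not_isSeparatingTriangle_of_isFacial (hl s (by simp)) ht
    rw [← ih (fun t ht => hl t (by simp [ht]))]
    rcases ccw_or_of_isFlip hs with h1 | h1
    · exact h1.potential_eq hne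
    · exact (h1.potential_eq hne).symm

theorem exists_flip_of_mem {T T' : G.ThreeOrientation} {l : List (Finset V)}
    (h : IsStepPath IsCcwFlip T l T') {t : Finset V} (ht : t ∈ l) :
    ∃ S S' : G.ThreeOrientation, S.IsCcwFlip t S' := by
  induction l generalizing T with
  | nil => simp at ht
  | cons s l ih =>
    obtain ⟨S, h1, h2⟩ := h
    rcases List.mem_cons.1 ht with rfl | ht
    · exact ⟨_, _, h1⟩
    · exact ih h2 ht

theorem isStepPath_isFlip {T T' : G.ThreeOrientation} {l : List (Finset V)}
    (h : IsStepPath IsCcwFlip T l T') : IsStepPath IsFlip T l T' := by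
  induction l generalizing T with
  | nil => exact h
  | cons s l ih =>
    obtain ⟨S, h1, h2⟩ := h
    exact ⟨S, isFlip_of_ccw h1, ih h2⟩

theorem isStepPath_isFlip_reverse {T T' : G.ThreeOrientation} {l : List (Finset V)}
    (h : IsStepPath IsFlip T l T') : IsStepPath IsFlip T' l.reverse T := by
  have h1 := h.reverse
  have h2 : (fun (x : G.ThreeOrientation) t y => IsFlip y t x) = IsFlip := by
    ext x t y
    exact ⟨IsFlip.symm, IsFlip.symm⟩
  rwa [h2] at h1

/-- Any two 3-orientations have a common upper bound, which is reached by flips of the triangles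
with different potentials. -/
theorem exists_join (T₁ T₂ : G.ThreeOrientation) : ∃ (J : G.ThreeOrientation) (v₁ v₂ : _),
    IsStepPath IsCcwFlip J v₁ T₁ ∧ IsStepPath IsCcwFlip J v₂ T₂ ∧
      (∀ t ∈ v₁, T₁.potential t ≠ T₂.potential t) ∧
      ∀ t ∈ v₂, T₁.potential t ≠ T₂.potential t := by
  obtain ⟨T₀, h₀, -⟩ := exists_unique_minimum T₁
  obtain ⟨l₁, hl₁⟩ := h₀ T₁
  obtain ⟨l₂, hl₂⟩ := h₀ T₂
  -- Exchange is used upwards from the minimum: the missing labels are counted by truncated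
  -- differences of potentials, so a label that occurs has different potentials.
  obtain ⟨J, v₁, v₂, h1, h2, h3, h4⟩ := IsStepPath.exchange
    (step := fun (x : G.ThreeOrientation) t y => IsCcwFlip y t x)
    (fun _ _ _ _ a b => a.det_symm b) (fun _ _ _ _ _ n a b => a.diamond_symm n b)
    (isCcwFlipSequence_iff.1 hl₁).reverse (isCcwFlipSequence_iff.1 hl₂).reverse
  simp only [List.count_reverse, count_eq_potential h₀ hl₁, count_eq_potential h₀ hl₂] at h3 h4
  refine ⟨J, v₁.reverse, v₂.reverse, h1.reverse, h2.reverse, fun t ht => ?_, fun t ht => ?_⟩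
  · have := h3 t
    have := List.count_pos_iff.2 (List.mem_reverse.1 ht)
    omega
  · have := h4 t
    have := List.count_pos_iff.2 (List.mem_reverse.1 ht)
    omega

/-- From `T₂` one climbs to the common upper bound and descends to `T₁`. Every triangle on the way
has different potentials, hence is not separating, hence is facial. The constant `8` is twice the
`4` of `length_le`. -/
theorem exists_facial_of_potential_eq {T₁ T₂ : G.ThreeOrientation}
    (h : ∀ t, G.IsSeparatingTriangle t → T₁.potential t = T₂.potential t) :
    ∃ l, T₂.IsFacialFlipSequence l T₁ ∧ l.length ≤ 8 * Fintype.card V ^ 2 := by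
  obtain ⟨J, v₁, v₂, h1, h2, h3, h4⟩ := exists_join T₁ T₂
  have hfac : ∀ {T : G.ThreeOrientation} {v : List (Finset V)}, IsStepPath IsCcwFlip J v T →
      ∀ t ∈ v, T₁.potential t ≠ T₂.potential t → G.IsFacial t := by
    intro T v hv t ht hne
    by_contra hc
    obtain ⟨S, S', C, a1, a2, a3, -⟩ := exists_flip_of_mem hv ht
    exact hne (h t (S.isSeparatingTriangle_of_not_isFacial a1 a2 a3 hc))
  refine ⟨v₂.reverse ++ v₁, ⟨isFlipSequence_iff.2
    ((isStepPath_isFlip_reverse (isStepPath_isFlip h2)).append (isStepPath_isFlip h1)),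
    fun t ht => ?_⟩, ?_⟩
  · rcases List.mem_append.1 ht with ht | ht
    · have ht := List.mem_reverse.1 ht
      exact hfac h2 t ht (h4 t ht)
    · exact hfac h1 t ht (h3 t ht)
  · rw [List.length_append, List.length_reverse]
    have := length_le h1
    have := length_le h2
    omega

end ThreeOrientation

end Height

end PlaneTriangulation

theorem mainTheorem4 :
    ∃ c : ℕ, ∀ (V : Type u) [Fintype V] [DecidableEq V] (G : PlaneTriangulation V)
      (T₁ T₂ : G.ThreeOrientation),
      -- the minimum 3-orientation exists, is unique, and the potential is well-defined
      ((∃! T₀ : G.ThreeOrientation, T₀.IsMinimum) ∧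
        ∀ (T T₀ : G.ThreeOrientation) (l : List (Finset V)) (t : Finset V),
          T₀.IsMinimum → T.IsCcwFlipSequence l T₀ → l.count t = T.potential t) ∧
      -- the characterization
      ((∃ l, T₂.IsFacialFlipSequence l T₁) ↔
        ∀ t, G.IsSeparatingTriangle t → (T₁.potential t : ℤ) - (T₂.potential t : ℤ) = 0) ∧
      -- the bound on the number of flips
      ((∃ l, T₂.IsFacialFlipSequence l T₁) →
        ∃ l, T₂.IsFacialFlipSequence l T₁ ∧ l.length ≤ c * Fintype.card V ^ 2) := by
  refine ⟨8, fun V _ _ G T₁ T₂ => ⟨⟨T₁.exists_unique_minimum,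
    fun T T₀ l t h₀ h => PlaneTriangulation.ThreeOrientation.count_eq_potential h₀ h t⟩,
    ⟨?_, ?_⟩, ?_⟩⟩
  · rintro ⟨l, hl⟩ t ht
    rw [PlaneTriangulation.ThreeOrientation.potential_eq_of_facial hl ht, sub_self]
  · intro h
    obtain ⟨l, hl, -⟩ := PlaneTriangulation.ThreeOrientation.exists_facial_of_potential_eq
      (T₁ := T₁) (T₂ := T₂) (fun t ht => by have := h t ht; omega)
    exact ⟨l, hl⟩
  · rintro ⟨l, hl⟩
    exact PlaneTriangulation.ThreeOrientation.exists_facial_of_potential_eq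
      (fun t ht => (PlaneTriangulation.ThreeOrientation.potential_eq_of_facial hl ht).symm)
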